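/- Let $n\ge 1$. For $\epsilon\in\{-1,1\}^n$ let $H_{\epsilon,\mathbb R}\subset\mathbb R^n$ be the hyperplane $\epsilon_1x_1+\cdots+\epsilon_nx_n=1$, and let $L_i$ be the hyperplane $x_i=0$ $(1\le i\le n)$. A linear subset is a nonempty intersection of some of these hyperplanes ($\mathbb R^n$ included). A $d$-chamber is a connected component of the complement, in a $d$-dimensional linear subset, of the union of the linear subsets properly contained in it. The group $\mu_2^n=\{1,-1\}^n$ acts on $\mathbb R^n$ and on the chambers by $(x_i)\mapsto(g_ix_i)$. Choose a point $v_\sigma\in\sigma$ in every chamber $\sigma$ such that $v_{g\sigma}=g\,v_\sigma$ for $g\in\mu_2^n$. For an $(n-k)$-chamber $\tau$, $k=0,1,2$, the dual cell $D_\tau\subset\mathbb R^n$ is the union of the simplices with vertices $v_{\sigma_0},\dots,v_{\sigma_k}$ over all flags $\overline{\sigma_0}\supset\cdots\supset\overline{\sigma_k}$ of $(n-j)$-chambers $\sigma_j$ with $\sigma_k=\tau$. Let $X_2$ be the $2$-dimensional Salvetti complex: it has one $k$-cell $\widetilde D_{\sigma,\tau}$, a copy of $D_\tau$, for each $n$-chamber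 $\sigma$ and each $(n-k)$-chamber $\tau\subset\overline\sigma$. The part $D_{\tau'}\subset D_\tau$ (for $\overline{\tau'}\supset\tau$) of $\widetilde D_{\sigma,\tau}$ is attached by the identity to $\widetilde D_{\sigma',\tau'}$, where $\sigma'$ is the $n$-chamber with $\overline{\sigma'}\supset\tau'$ lying on the same side as $\sigma$ of all the hyperplanes containing $\tau'$. For an $(n-1)$-chamber $\tau$, $\widetilde D_{\sigma,\tau}$ is viewed as an arrow from $v_\sigma$, through $v_\tau$, to $v_{\rho_\tau(\sigma)}$, where $\rho_\tau(\sigma)\ne\sigma$ is the other $n$-chamber whose closure contains $\tau$. Let $\overline{X_2}=X_2/\mu_2^n$. Let $h(\sigma)$ be the number of hyperplanes $H_{\epsilon,\mathbb R}$ separating $0$ from $v_\sigma$. The spanning complex $\mathcal S\subset\overline{X_2}$ is the union of the $0$-cells and of the images of the following cells $\widetilde D_{\sigma,\tau}$ with $\sigma\subset\mathbb R^n_{\ge0}$: the $1$-cells such that $\tau\subset H_{\epsilon,\mathbb R}$ for some $\epsilon$ and $h(\sigma)+1=h(\rho_\tau(\sigma))$; and the $2$-cells such that $\tau\subset H_{\epsilon,\mathbb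 R}\cap H_{\epsilon',\mathbb R}$ for some $\epsilon,\epsilon'$ differing in at least two coordinates and $h(\sigma)$ is minimal among the $n$-chambers whose closure contains $\tau$. Let $\overline{X_2}^{(s)}$ be the space obtained from $\overline{X_2}$ by contracting $\mathcal S$ to a point $s$. Every $1$-cell then defines an element of $\pi_1(\overline{X_2}^{(s)},s)$, where $ab$ denotes the path $a$ followed by the path $b$. Put $\sigma_0=\{x_j>0\ (1\le j\le n),\ \sum_j x_j<1\}$, $\tau_0=\{x_j>0\ (1\le j\le n),\ \sum_j x_j=1\}$ and $\tau_i=\{x_j>0\ (j\ne i),\ x_i=0,\ \sum_j x_j<1\}$ for $1\le i\le n$. Let $\gamma_0$ be the class of the arrow $\widetilde D_{\rho_{\tau_0}(\sigma_0),\tau_0}$ across $\tau_0$ towards the origin, and for $1\le i\le n$ let $\gamma_i$ be the class of the arrow $\widetilde D_{\sigma_0,\tau_i}$. For $\epsilon\in\{-1,1\}^n$ let $S(\epsilon)=\{i\mid\epsilon_i=-1\}$ and $m_\epsilon=\prod_{i\in S(\epsilon)}\gamma_i$, the product being taken in any order. **Theorem.** For every such choice of the points $v_\sigma$ and all $\epsilon,\epsilon'\in\{-1,1\}^n$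 with $H_{\epsilon,\mathbb R}\cap H_{\epsilon',\mathbb R}\cap\mathbb R^n_{>0}\neq\emptyset$, and whatever orders are used in the products $m_\epsilon$ and $m_{\epsilon'}$, $$[m_\epsilon^{-1}\gamma_0m_\epsilon,\;m_{\epsilon'}^{-1}\gamma_0m_{\epsilon'}]=1\quad\text{in }\pi_1(\overline{X_2}^{(s)},s).$$ -/

import Mathlib

open Set
open scoped commutatorElement

namespace LauricellaFC

/-! ## The real arrangement and its chambers -/

/-- The action of a sign vector `g ∈ {1,-1}ⁿ` on `ℝⁿ`: `(x₁,…,xₙ) ↦ (g₁x₁,…,gₙxₙ)`. -/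
def signAct {n : ℕ} (g : Fin n → ℤˣ) (x : Fin n → ℝ) : Fin n → ℝ :=
  fun i => ((g i : ℤ) : ℝ) * x i

/-- The real hyperplane `ε₁x₁ + ⋯ + εₙxₙ = 1`. -/
def hypEps {n : ℕ} (ε : Fin n → ℤˣ) : Set (Fin n → ℝ) :=
  {x | ∑ i, ((ε i : ℤ) : ℝ) * x i = 1}

/-- The real coordinate hyperplane `xᵢ = 0`. -/
def hypCoord {n : ℕ} (i : Fin n) : Set (Fin n → ℝ) :=
  {x | x i = 0}

/-- The `n`-dimensional `F_C`-arrangement (real points of its hyperplanes). -/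
def arrangement (n : ℕ) : Set (Set (Fin n → ℝ)) :=
  range hypEps ∪ range hypCoord

/-- A (nonempty) intersection of hyperplanes of the arrangement; `ℝⁿ` itself is the
empty intersection. -/
def IsLinearSubset {n : ℕ} (L : Set (Fin n → ℝ)) : Prop :=
  L.Nonempty ∧ ∃ B ⊆ arrangement n, L = ⋂₀ B

/-- The complement in `L` of the union of all linear subsets properly contained in `L`. -/
def openPart {n : ℕ} (L : Set (Fin n → ℝ)) : Set (Fin n → ℝ) :=
  L \ ⋃₀ {L' | IsLinearSubset L' ∧ L' ⊂ L}

/-- `C` is an `(n - k)`-chamber: a connected component of the open part of an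
`(n - k)`-dimensional linear subset. -/
def IsChamber {n : ℕ} (k : ℕ) (C : Set (Fin n → ℝ)) : Prop :=
  ∃ L : Set (Fin n → ℝ), IsLinearSubset L ∧ Module.finrank ℝ (vectorSpan ℝ L) + k = n ∧
    ∃ x ∈ openPart L, C = connectedComponentIn (openPart L) x

/-- The set `H` meets the segment from `x` to `y`.  For a hyperplane containing neither
`x` nor `y` this says that `H` separates `x` from `y`. -/
def Separates {n : ℕ} (H : Set (Fin n → ℝ)) (x y : Fin n → ℝ) : Prop :=
  (segment ℝ x y ∩ H).Nonempty

/-- A choice of a point `v_C` in every chamber `C` (of every dimension), stable under the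
action of `{1,-1}ⁿ`.  (The value at sets that are not chambers is irrelevant.) -/
structure VertexChoice (n : ℕ) where
  pt : Set (Fin n → ℝ) → (Fin n → ℝ)
  pt_mem : ∀ (k : ℕ) (C : Set (Fin n → ℝ)), IsChamber k C → pt C ∈ C
  pt_signAct : ∀ (k : ℕ) (C : Set (Fin n → ℝ)) (g : Fin n → ℤˣ), IsChamber k C →
    pt (signAct g '' C) = signAct g (pt C)

/-! ## The Salvetti complex -/

/-- The dual cell `D_τ ⊆ ℝⁿ` of an `(n - k)`-chamber `τ`, for `k ≤ 2`: the union of the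
simplices `Δ(v_{σ₀}, …, v_{σₖ})` over the flags of chambers of dimensions
`n, n - 1, …, n - k` that descend to `σₖ = τ`. -/
def dualCell {n : ℕ} (v : VertexChoice n) : ℕ → Set (Fin n → ℝ) → Set (Fin n → ℝ)
  | 0, τ => {v.pt τ}
  | 1, τ => {x | ∃ σ, IsChamber 0 σ ∧ τ ⊆ closure σ ∧ x ∈ segment ℝ (v.pt σ) (v.pt τ)}
  | 2, τ => {x | ∃ σ ρ, IsChamber 0 σ ∧ IsChamber 1 ρ ∧ ρ ⊆ closure σ ∧ τ ⊆ closure ρ ∧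
      x ∈ convexHull ℝ {v.pt σ, v.pt ρ, v.pt τ}}
  | _, _ => ∅

/-- The index of a `k`-cell (`k ≤ 2`): an `n`-chamber `σ` and an `(n - k)`-chamber `τ` in its
closure.  For `k = 0` necessarily `τ = σ`. -/
structure Cell (n : ℕ) where
  codim : ℕ
  codim_le : codim ≤ 2
  chamber : Set (Fin n → ℝ)
  face : Set (Fin n → ℝ)
  isChamber_chamber : IsChamber 0 chamber
  isChamber_face : IsChamber codim face
  face_subset : face ⊆ closure chamber

/-- The disjoint union of the closed cells: one copy of the dual cell `D_τ` for every
index `(σ, τ)`. -/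
abbrev CellSpace {n : ℕ} (v : VertexChoice n) : Type :=
  Σ c : Cell n, dualCell v c.codim c.face

/-- The attaching relation: a point `x` of the copy of `D_τ` indexed by `(σ, τ)` that lies in
`D_τ'`, for a chamber `τ'` with `τ ⊆ closure τ'`, is identified with the point `x` of the copy
of `D_τ'` indexed by `(σ', τ')`, where `σ'` is the `n`-chamber adjacent to `τ'` that lies on the
same side as `σ` of all the hyperplanes containing `τ'`. -/
def Attach {n : ℕ} (v : VertexChoice n) (p q : CellSpace v) : Prop :=
  p.1.face ⊆ closure q.1.face ∧ (p.2 : Fin n → ℝ) = (q.2 : Fin n → ℝ) ∧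
    ∀ H ∈ arrangement n, q.1.face ⊆ H →
      ¬ Separates H (v.pt p.1.chamber) (v.pt q.1.chamber)

/-- The `2`-dimensional complex `X₂`, with the quotient topology. -/
abbrev XTwo {n : ℕ} (v : VertexChoice n) : Type := Quot (Attach v)

/-- Two points of `X₂` are in the same `{1,-1}ⁿ`-orbit: a sign vector `g` carries the copy of
`D_τ` indexed by `(σ, τ)` to the copy of `D_{gτ} = g D_τ` indexed by `(gσ, gτ)`, acting on
points by `x ↦ g x`. -/
def OrbitRel {n : ℕ} (v : VertexChoice n) (a b : XTwo v) : Prop :=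
  ∃ (g : Fin n → ℤˣ) (p q : CellSpace v), a = Quot.mk _ p ∧ b = Quot.mk _ q ∧
    q.1.chamber = signAct g '' p.1.chamber ∧ q.1.face = signAct g '' p.1.face ∧
    (q.2 : Fin n → ℝ) = signAct g (p.2 : Fin n → ℝ)

/-- The quotient of `X₂` by the action of `{1,-1}ⁿ`. -/
abbrev XBar {n : ℕ} (v : VertexChoice n) : Type := Quot (OrbitRel v)

/-- The number of hyperplanes `H_ε` that separate the origin from the vertex `v_σ`. -/
noncomputable def height {n : ℕ} (v : VertexChoice n) (σ : Set (Fin n → ℝ)) : ℕ :=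
  {ε : Fin n → ℤˣ | Separates (hypEps ε) 0 (v.pt σ)}.ncard

/-- `1`-cells crossing a hyperplane `H_ε` away from the origin, with `σ` in the closed
positive orthant. -/
def Cell.IsSpanningOne {n : ℕ} (v : VertexChoice n) (c : Cell n) : Prop :=
  c.codim = 1 ∧ (∀ x ∈ c.chamber, ∀ i, 0 ≤ x i) ∧ (∃ ε : Fin n → ℤˣ, c.face ⊆ hypEps ε) ∧
    ∃ σ' : Set (Fin n → ℝ), IsChamber 0 σ' ∧ σ' ≠ c.chamber ∧ c.face ⊆ closure σ' ∧
      height v c.chamber + 1 = height v σ'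

/-- `2`-cells `(σ, τ)` with `σ` in the closed positive orthant, `τ` in an intersection
`H_ε ∩ H_ε'` where `ε` and `ε'` differ in at least two places, and `σ` of minimal height among
the `n`-chambers around `τ`. -/
def Cell.IsSpanningTwo {n : ℕ} (v : VertexChoice n) (c : Cell n) : Prop :=
  c.codim = 2 ∧ (∀ x ∈ c.chamber, ∀ i, 0 ≤ x i) ∧
    (∃ ε ε' : Fin n → ℤˣ, 2 ≤ {i | ε i ≠ ε' i}.ncard ∧ c.face ⊆ hypEps ε ∩ hypEps ε') ∧
    ∀ σ' : Set (Fin n → ℝ), IsChamber 0 σ' → c.face ⊆ closure σ' →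
      height v c.chamber ≤ height v σ'

/-- The spanning complex: the union of the images of the spanning `1`-cells and `2`-cells.
The `0`-cells are listed too; for `n ≥ 1` each of them is an end point of a spanning `1`-cell. -/
def spanningComplex {n : ℕ} (v : VertexChoice n) : Set (XBar v) :=
  {a | ∃ p : CellSpace v, a = Quot.mk _ (Quot.mk _ p) ∧
    (p.1.codim = 0 ∨ p.1.IsSpanningOne v ∨ p.1.IsSpanningTwo v)}

/-- The space obtained from `X₂ / {1,-1}ⁿ` by contracting the spanning complex to a point. -/
abbrev XBarS {n : ℕ} (v : VertexChoice n) : Type :=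
  Quot fun a b : XBar v => a ∈ spanningComplex v ∧ b ∈ spanningComplex v

/-- The composite of the quotient maps. -/
def toXBarS {n : ℕ} (v : VertexChoice n) (p : CellSpace v) : XBarS v :=
  Quot.mk _ (Quot.mk _ (Quot.mk _ p))

theorem continuous_toXBarS {n : ℕ} (v : VertexChoice n) : Continuous (toXBarS v) :=
  continuous_quot_mk.comp (continuous_quot_mk.comp continuous_quot_mk)

/-- The `0`-cell of an `n`-chamber. -/
def vertexCell {n : ℕ} (σ : Set (Fin n → ℝ)) (h : IsChamber 0 σ) : Cell n where
  codim := 0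
  codim_le := by norm_num
  chamber := σ
  face := σ
  isChamber_chamber := h
  isChamber_face := h
  face_subset := subset_closure

/-- The vertex `v_σ`. -/
def vertex {n : ℕ} (v : VertexChoice n) (σ : Set (Fin n → ℝ)) (h : IsChamber 0 σ) :
    CellSpace v :=
  ⟨vertexCell σ h, ⟨v.pt σ, rfl⟩⟩

theorem toXBarS_vertex_eq {n : ℕ} (v : VertexChoice n) {σ σ' : Set (Fin n → ℝ)}
    (h : IsChamber 0 σ) (h' : IsChamber 0 σ') :
    toXBarS v (vertex v σ h) = toXBarS v (vertex v σ' h') :=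
  Quot.sound ⟨⟨_, rfl, Or.inl rfl⟩, ⟨_, rfl, Or.inl rfl⟩⟩

/-- An `n`-chamber is disjoint from all the hyperplanes. -/
theorem IsChamber.not_subset {n : ℕ} {σ H : Set (Fin n → ℝ)} (h : IsChamber 0 σ)
    (hH : H ∈ arrangement n) : ¬ σ ⊆ H := by
  intro hs
  obtain ⟨L, hL, hd, x, hx, rfl⟩ := h
  have hxH : x ∈ H := hs (mem_connectedComponentIn hx)
  refine hx.2 ⟨L ∩ H, ⟨⟨⟨x, hx.1, hxH⟩, ?_⟩, ?_⟩, hx.1, hxH⟩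
  · obtain ⟨_, B, hB, rfl⟩ := hL
    exact ⟨insert H B, insert_subset hH hB, by rw [sInter_insert, inter_comm]⟩
  · refine ssubset_of_subset_of_ne inter_subset_left fun he => ?_
    have hLH : L ⊆ H := fun y hy => (he.symm ▸ hy : y ∈ L ∩ H).2
    have htop : vectorSpan ℝ L = ⊤ := by
      apply Submodule.eq_top_of_finrank_eq
      simpa using hd
    -- a functional that is constant on `L` vanishes on the vector span of `L`
    have key : ∀ (l : (Fin n → ℝ) →ₗ[ℝ] ℝ) (c : ℝ), (∀ y ∈ L, l y = c) → l = 0 := by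
      intro l c hl
      have : vectorSpan ℝ L ≤ LinearMap.ker l := by
        rw [vectorSpan_def, Submodule.span_le]
        rintro _ ⟨a, ha, b, hb, rfl⟩
        simp [hl a ha, hl b hb]
      rw [htop, top_le_iff, LinearMap.ker_eq_top] at this
      exact this
    rcases hH with ⟨ε, rfl⟩ | ⟨i, rfl⟩
    · have := key (∑ i, ((ε i : ℤ) : ℝ) • LinearMap.proj i) 1 (fun y hy => by
        have h0 : ∑ i, ((ε i : ℤ) : ℝ) * y i = 1 := hLH hy
        simpa using h0)
      have h1 := hLH hx.1
      have h2 := congrArg (fun l => l x) this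
      simp only [LinearMap.sum_apply, LinearMap.smul_apply, LinearMap.proj_apply,
        LinearMap.zero_apply, smul_eq_mul] at h2
      have h3 : ∑ i, ((ε i : ℤ) : ℝ) * x i = 1 := h1
      rw [h2] at h3
      exact zero_ne_one h3
    · have := key (LinearMap.proj i) 0 (fun y hy => hLH hy)
      have h2 := congrArg (fun l => l (fun _ => 1)) this
      simp at h2

/-! ## The loop defined by a `1`-cell -/

/-- The arrow from the `n`-chamber `source` to the `n`-chamber `target` on the opposite side of
the `(n - 1)`-chamber `face`. -/
structure Arrow (n : ℕ) where
  source : Set (Fin n → ℝ)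
  face : Set (Fin n → ℝ)
  target : Set (Fin n → ℝ)
  isChamber_source : IsChamber 0 source
  isChamber_face : IsChamber 1 face
  isChamber_target : IsChamber 0 target
  face_subset_source : face ⊆ closure source
  face_subset_target : face ⊆ closure target
  source_ne_target : source ≠ target

/-- The `1`-cell of an arrow. -/
def Arrow.cell {n : ℕ} (a : Arrow n) : Cell n where
  codim := 1
  codim_le := by norm_num
  chamber := a.source
  face := a.face
  isChamber_chamber := a.isChamber_source
  isChamber_face := a.isChamber_face
  face_subset := a.face_subset_source

/-- The straight path along a segment contained in `S`. -/
noncomputable def segmentPath {n : ℕ} {S : Set (Fin n → ℝ)} {x y : Fin n → ℝ}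
    (h : segment ℝ x y ⊆ S) :
    Path (⟨x, h (left_mem_segment ℝ x y)⟩ : S) ⟨y, h (right_mem_segment ℝ x y)⟩ where
  toFun t := ⟨AffineMap.lineMap x y (t : ℝ), h (by
    rw [segment_eq_image_lineMap]; exact ⟨t, t.2, rfl⟩)⟩
  continuous_toFun := by
    refine Continuous.subtype_mk ?_ _
    exact AffineMap.lineMap_continuous.comp continuous_subtype_val
  source' := by simp
  target' := by simp

theorem Arrow.segment_source_subset {n : ℕ} (v : VertexChoice n) (a : Arrow n) :
    segment ℝ (v.pt a.source) (v.pt a.face) ⊆ dualCell v 1 a.face :=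
  fun _ hx => ⟨a.source, a.isChamber_source, a.face_subset_source, hx⟩

theorem Arrow.segment_target_subset {n : ℕ} (v : VertexChoice n) (a : Arrow n) :
    segment ℝ (v.pt a.target) (v.pt a.face) ⊆ dualCell v 1 a.face :=
  fun _ hx => ⟨a.target, a.isChamber_target, a.face_subset_target, hx⟩

/-- The path in the copy of `D_τ` indexed by `(σ, τ)` that runs from `v_σ` through `v_τ` to
the vertex on the opposite side. -/
noncomputable def Arrow.path {n : ℕ} (v : VertexChoice n) (a : Arrow n) :
    Path (⟨v.pt a.source, a.segment_source_subset v (left_mem_segment ℝ _ _)⟩ :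
        dualCell v a.cell.codim a.cell.face)
      ⟨v.pt a.target, a.segment_target_subset v (left_mem_segment ℝ _ _)⟩ :=
  (segmentPath (a.segment_source_subset v)).trans (segmentPath (a.segment_target_subset v)).symm

theorem Arrow.toXBarS_eq {n : ℕ} (v : VertexChoice n) (a : Arrow n)
    {σ σ' : Set (Fin n → ℝ)} (h : IsChamber 0 σ) (h' : IsChamber 0 σ')
    (hs : a.face ⊆ closure σ) (hm : v.pt σ ∈ dualCell v a.cell.codim a.cell.face) :
    toXBarS v (vertex v σ' h') = toXBarS v ⟨a.cell, ⟨v.pt σ, hm⟩⟩ := by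
  rw [toXBarS_vertex_eq v h' h]
  refine congrArg (fun z => Quot.mk _ (Quot.mk _ z)) (Quot.sound ?_).symm
  exact ⟨hs, rfl, fun H hH hsub => (h.not_subset hH hsub).elim⟩

/-! ## The elements `γ₀, γ₁, …, γₙ` -/

/-- The chamber `xᵢ > 0`, `∑ xᵢ < 1`. -/
def sigmaZero (n : ℕ) : Set (Fin n → ℝ) :=
  {x | (∀ i, 0 < x i) ∧ ∑ i, x i < 1}

/-- The `(n-1)`-chamber `xᵢ > 0`, `∑ xᵢ = 1`. -/
def tauZero (n : ℕ) : Set (Fin n → ℝ) :=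
  {x | (∀ i, 0 < x i) ∧ ∑ i, x i = 1}

/-- The `(n-1)`-chamber `xᵢ = 0`, `xⱼ > 0` for `j ≠ i`, `∑ xⱼ < 1`. -/
def tauCoord {n : ℕ} (i : Fin n) : Set (Fin n → ℝ) :=
  {x | (∀ j, j ≠ i → 0 < x j) ∧ ∑ j, x j < 1 ∧ x i = 0}

/-- The chamber on the opposite side of `sigmaZero` with respect to `tauZero`. -/
def sigmaOut (n : ℕ) : Set (Fin n → ℝ) :=
  {x | (∀ i, 0 < x i) ∧ 1 < ∑ i, x i ∧
    ∀ ε : Fin n → ℤˣ, ε ≠ 1 → ∑ i, ((ε i : ℤ) : ℝ) * x i < 1}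

/-- The reflection in the `i`-th coordinate hyperplane. -/
def reflection {n : ℕ} (i : Fin n) : Fin n → ℤˣ := Function.update 1 i (-1)

/-- The chamber on the opposite side of `sigmaZero` with respect to `tauCoord i`. -/
def sigmaReflected {n : ℕ} (i : Fin n) : Set (Fin n → ℝ) :=
  signAct (reflection i) '' sigmaZero n

/-! ### These sets are chambers -/

/-- The affine forms defining the hyperplanes. -/
def form {n : ℕ} : (Fin n → ℤˣ) ⊕ Fin n → (Fin n → ℝ) → ℝ
  | Sum.inl ε, x => ∑ i, ((ε i : ℤ) : ℝ) * x i - 1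
  | Sum.inr i, x => x i

theorem form_comb {n : ℕ} (j : (Fin n → ℤˣ) ⊕ Fin n) (x y : Fin n → ℝ) {a b : ℝ}
    (hab : a + b = 1) : form j (a • x + b • y) = a * form j x + b * form j y := by
  cases j with
  | inl ε =>
    simp only [form, Pi.add_apply, Pi.smul_apply, smul_eq_mul, mul_add, Finset.sum_add_distrib,
      mul_sub, Finset.mul_sum]
    have h1 : ∀ c : ℝ, ∀ z : Fin n → ℝ, ∑ i, ((ε i : ℤ) : ℝ) * (c * z i)
        = ∑ i, c * (((ε i : ℤ) : ℝ) * z i) := fun c z => Finset.sum_congr rfl fun i _ => by ring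
    rw [h1, h1]
    linarith
  | inr i => simp [form]

theorem continuous_form {n : ℕ} (j : (Fin n → ℤˣ) ⊕ Fin n) : Continuous (form j) := by
  cases j with
  | inl ε =>
    change Continuous fun x : Fin n → ℝ => ∑ i, ((ε i : ℤ) : ℝ) * x i - 1
    fun_prop
  | inr i => exact continuous_apply i

theorem mem_arrangement_iff {n : ℕ} (H : Set (Fin n → ℝ)) :
    H ∈ arrangement n ↔ ∃ j, H = {x | form j x = 0} := by
  constructor
  · rintro (⟨ε, rfl⟩ | ⟨i, rfl⟩)
    · exact ⟨Sum.inl ε, by ext x; simp [hypEps, form, sub_eq_zero]⟩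
    · exact ⟨Sum.inr i, by ext x; simp [hypCoord, form]⟩
  · rintro ⟨j | j, rfl⟩
    · exact Or.inl ⟨j, by ext x; simp [hypEps, form, sub_eq_zero]⟩
    · exact Or.inr ⟨j, by ext x; simp [hypCoord, form]⟩

/-- The set of points at which the forms have prescribed signs. -/
def signCell {n : ℕ} (s : (Fin n → ℤˣ) ⊕ Fin n → SignType) : Set (Fin n → ℝ) :=
  {x | ∀ j, SignType.sign (form j x) = s j}

theorem sign_comb {p q a b : ℝ} {s : SignType} (hp : SignType.sign p = s)
    (hq : SignType.sign q = 0 ∨ SignType.sign q = s) (ha : 0 < a) (hb : 0 ≤ b) :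
    SignType.sign (a * p + b * q) = s := by
  subst hp
  rcases lt_trichotomy p 0 with h | h | h
  · have hq' : q ≤ 0 := by
      rcases hq with hq | hq
      · exact (sign_eq_zero_iff.1 hq).le
      · rw [sign_neg h] at hq; exact (sign_eq_neg_one_iff.1 hq).le
    rw [sign_neg h, sign_eq_neg_one_iff]
    nlinarith [mul_neg_of_pos_of_neg ha h, mul_nonpos_of_nonneg_of_nonpos hb hq']
  · have hq' : q = 0 := by
      rcases hq with hq | hq
      · exact sign_eq_zero_iff.1 hq
      · rw [h, sign_zero] at hq; exact sign_eq_zero_iff.1 hq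
    simp [h, hq']
  · have hq' : 0 ≤ q := by
      rcases hq with hq | hq
      · exact (sign_eq_zero_iff.1 hq).ge
      · rw [sign_pos h] at hq; exact (sign_eq_one_iff.1 hq).le
    rw [sign_pos h, sign_eq_one_iff]
    nlinarith [mul_pos ha h, mul_nonneg hb hq']

theorem convex_signCell {n : ℕ} (s : (Fin n → ℤˣ) ⊕ Fin n → SignType) :
    Convex ℝ (signCell s) := by
  rw [convex_iff_forall_pos]
  intro x hx y hy a b ha hb hab j
  rw [form_comb j x y hab]
  exact sign_comb (hx j) (Or.inr (hy j)) ha hb.le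

/-- If `t` arises from `s` by replacing some signs by `0`, then the cell of `t` is in the
closure of the cell of `s`. -/
theorem signCell_subset_closure {n : ℕ} {s t : (Fin n → ℤˣ) ⊕ Fin n → SignType}
    (hne : (signCell s).Nonempty) (hst : ∀ j, t j = 0 ∨ t j = s j) :
    signCell t ⊆ closure (signCell s) := by
  intro y hy
  obtain ⟨x, hx⟩ := hne
  have hsub : openSegment ℝ x y ⊆ signCell s := by
    rintro _ ⟨a, b, ha, hb, hab, rfl⟩ j
    rw [form_comb j x y hab]
    refine sign_comb (hx j) ?_ ha hb.le
    rw [hy j]; exact hst j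
  have := closure_mono hsub
  rw [closure_openSegment] at this
  exact this (right_mem_segment ℝ x y)

/-- A nonempty sign cell is a chamber of the linear subset that is cut out by the forms
vanishing on it. -/
theorem isChamber_signCell {n k : ℕ} {s : (Fin n → ℤˣ) ⊕ Fin n → SignType}
    (hne : (signCell s).Nonempty)
    (hd : Module.finrank ℝ (vectorSpan ℝ {y : Fin n → ℝ | ∀ j, s j = 0 → form j y = 0}) + k = n) :
    IsChamber k (signCell s) := by
  obtain ⟨x, hx⟩ := hne
  set L : Set (Fin n → ℝ) := {y | ∀ j, s j = 0 → form j y = 0} with hLdef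
  have hmemL : ∀ y ∈ signCell s, y ∈ L := fun y hy j hj => by
    have := hy j; rw [hj] at this; exact sign_eq_zero_iff.1 this
  -- no point of the sign cell is in a proper linear subset
  have hproper : ∀ y ∈ signCell s, y ∈ openPart L := by
    intro y hy
    refine ⟨hmemL y hy, ?_⟩
    rintro ⟨L', ⟨⟨_, B, hB, rfl⟩, hlt⟩, hyL'⟩
    refine hlt.2 fun z hz H hH => ?_
    obtain ⟨j, rfl⟩ := (mem_arrangement_iff H).1 (hB hH)
    have hyj : form j y = 0 := hyL' _ hH
    refine hz j ?_
    rw [← hy j, hyj, sign_zero]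
  have hL : IsLinearSubset L := by
    refine ⟨⟨x, hmemL x hx⟩, {H | ∃ j, s j = 0 ∧ H = {y | form j y = 0}}, ?_, ?_⟩
    · rintro H ⟨j, _, rfl⟩
      exact (mem_arrangement_iff _).2 ⟨j, rfl⟩
    · ext y
      constructor
      · rintro hy H ⟨j, hj, rfl⟩
        exact hy j hj
      · intro hy j hj
        exact hy _ ⟨j, hj, rfl⟩
  refine ⟨L, hL, hd, x, hproper x hx, Subset.antisymm ?_ ?_⟩
  · exact (convex_signCell s).isPreconnected.subset_connectedComponentIn hx hproper
  · intro y hy j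
    have hK : IsPreconnected (connectedComponentIn (openPart L) x) :=
      isPreconnected_connectedComponentIn
    have hKsub := connectedComponentIn_subset (openPart L) x
    have hxK := mem_connectedComponentIn (hproper x hx)
    by_cases hj : s j = 0
    · rw [hj, (hKsub hy).1 j hj, sign_zero]
    have hxj : form j x ≠ 0 := fun h => hj (by rw [← hx j, h, sign_zero])
    have hnz : ∀ z ∈ connectedComponentIn (openPart L) x, form j z ≠ 0 := by
      intro z hz hz0
      have hzo := hKsub hz
      refine hzo.2 ⟨L ∩ {y | form j y = 0}, ⟨⟨⟨z, hzo.1, hz0⟩, ?_⟩, ?_⟩, hzo.1, hz0⟩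
      · obtain ⟨_, B, hB, hBe⟩ := hL
        refine ⟨insert {y | form j y = 0} B,
          insert_subset ((mem_arrangement_iff _).2 ⟨j, rfl⟩) hB, ?_⟩
        rw [sInter_insert, inter_comm, hBe]
      · refine ssubset_of_subset_of_ne inter_subset_left fun he => hxj ?_
        have : x ∈ L ∩ {y | form j y = 0} := by rw [he]; exact hmemL x hx
        exact this.2
    rw [← hx j]
    rcases lt_or_gt_of_ne hxj with h1 | h1 <;> rcases lt_or_gt_of_ne (hnz y hy) with h2 | h2
    · rw [sign_neg h1, sign_neg h2]
    · obtain ⟨z, hz, hz0⟩ := hK.intermediate_value hxK hy (continuous_form j).continuousOn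
        ⟨h1.le, h2.le⟩
      exact (hnz z hz hz0).elim
    · obtain ⟨z, hz, hz0⟩ := hK.intermediate_value hy hxK (continuous_form j).continuousOn
        ⟨h2.le, h1.le⟩
      exact (hnz z hz hz0).elim
    · rw [sign_pos h1, sign_pos h2]

theorem vectorSpan_levelSet {n : ℕ} (l : (Fin n → ℝ) →ₗ[ℝ] ℝ) (c : ℝ) {x : Fin n → ℝ}
    (hx : l x = c) : vectorSpan ℝ {y | l y = c} = LinearMap.ker l := by
  apply le_antisymm
  · rw [vectorSpan_def, Submodule.span_le]
    rintro _ ⟨a, ha, b, hb, rfl⟩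
    have ha' : l a = c := ha
    have hb' : l b = c := hb
    simp [ha', hb']
  · intro z hz
    have hz' : l z = 0 := hz
    have : (z + x) -ᵥ x ∈ vectorSpan ℝ {y | l y = c} :=
      vsub_mem_vectorSpan ℝ (by simp [hz', hx]) hx
    simpa using this

theorem finrank_levelSet {n : ℕ} (l : (Fin n → ℝ) →ₗ[ℝ] ℝ) (c : ℝ) {x : Fin n → ℝ}
    (hx : l x = c) (hl : l ≠ 0) :
    Module.finrank ℝ (vectorSpan ℝ {y | l y = c}) + 1 = n := by
  rw [vectorSpan_levelSet l c hx]
  have := Module.Dual.finrank_ker_add_one_of_ne_zero (f := l) hl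
  simpa using this

theorem isChamber_zero_signCell {n : ℕ} {s : (Fin n → ℤˣ) ⊕ Fin n → SignType}
    (hne : (signCell s).Nonempty) (hs : ∀ j, s j ≠ 0) : IsChamber 0 (signCell s) := by
  refine isChamber_signCell hne ?_
  have h1 : {y : Fin n → ℝ | ∀ j, s j = 0 → form j y = 0}
      = {y | (0 : (Fin n → ℝ) →ₗ[ℝ] ℝ) y = 0} := by
    ext y; simp [hs]
  rw [h1, vectorSpan_levelSet 0 0 (x := 0) (by simp), LinearMap.ker_zero]
  simp

/-- Sign vectors of the five sets above. -/
def signOfSigmaZero (n : ℕ) : (Fin n → ℤˣ) ⊕ Fin n → SignType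
  | Sum.inl _ => -1
  | Sum.inr _ => 1

open Classical in
noncomputable def signOfTauZero (n : ℕ) : (Fin n → ℤˣ) ⊕ Fin n → SignType
  | Sum.inl ε => if ε = 1 then 0 else -1
  | Sum.inr _ => 1

open Classical in
noncomputable def signOfSigmaOut (n : ℕ) : (Fin n → ℤˣ) ⊕ Fin n → SignType
  | Sum.inl ε => if ε = 1 then 1 else -1
  | Sum.inr _ => 1

def signOfTauCoord {n : ℕ} (i : Fin n) : (Fin n → ℤˣ) ⊕ Fin n → SignType
  | Sum.inl _ => -1
  | Sum.inr j => if j = i then 0 else 1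

def signOfSigmaReflected {n : ℕ} (i : Fin n) : (Fin n → ℤˣ) ⊕ Fin n → SignType
  | Sum.inl _ => -1
  | Sum.inr j => if j = i then -1 else 1

theorem unit_cases (u : ℤˣ) : ((u : ℤ) : ℝ) = 1 ∨ ((u : ℤ) : ℝ) = -1 := by
  rcases Int.units_eq_one_or u with h | h <;> simp [h]

theorem unit_mul_self (u : ℤˣ) : ((u : ℤ) : ℝ) * ((u : ℤ) : ℝ) = 1 := by
  rcases unit_cases u with h | h <;> rw [h] <;> norm_num

theorem sum_signs_le {n : ℕ} (ε : Fin n → ℤˣ) {x : Fin n → ℝ} (hx : ∀ i, 0 ≤ x i) :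
    ∑ i, ((ε i : ℤ) : ℝ) * x i ≤ ∑ i, x i :=
  Finset.sum_le_sum fun i _ => by
    rcases unit_cases (ε i) with h | h <;> rw [h] <;> linarith [hx i]

theorem sum_signs_add_le {n : ℕ} {ε : Fin n → ℤˣ} (hε : ε ≠ 1) {x : Fin n → ℝ} {c : ℝ}
    (hc : 0 ≤ c) (hx : ∀ i, c ≤ x i) :
    ∑ i, ((ε i : ℤ) : ℝ) * x i + 2 * c ≤ ∑ i, x i := by
  obtain ⟨k, hk⟩ := Function.ne_iff.1 hε
  have hk' : ((ε k : ℤ) : ℝ) = -1 := by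
    rcases Int.units_eq_one_or (ε k) with h | h
    · exact (hk h).elim
    · simp [h]
  have h1 : ∀ i ∈ Finset.univ, 0 ≤ x i - ((ε i : ℤ) : ℝ) * x i := fun i _ => by
    rcases unit_cases (ε i) with h | h <;> rw [h] <;> linarith [hx i]
  have h2 := Finset.single_le_sum h1 (Finset.mem_univ k)
  rw [Finset.sum_sub_distrib, hk'] at h2
  linarith [hx k]

theorem sigmaZero_eq (n : ℕ) : sigmaZero n = signCell (signOfSigmaZero n) := by
  ext x
  constructor
  · rintro ⟨h1, h2⟩ (ε | i)
    · simp only [form, signOfSigmaZero, sign_eq_neg_one_iff]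
      linarith [sum_signs_le ε (fun i => (h1 i).le)]
    · simpa [form, signOfSigmaZero, sign_eq_one_iff] using h1 i
  · intro h
    refine ⟨fun i => ?_, ?_⟩
    · simpa [form, signOfSigmaZero, sign_eq_one_iff] using h (Sum.inr i)
    · simpa [form, signOfSigmaZero, sign_eq_neg_one_iff] using h (Sum.inl 1)

theorem tauZero_eq (n : ℕ) [NeZero n] : tauZero n = signCell (signOfTauZero n) := by
  ext x
  constructor
  · rintro ⟨h1, h2⟩ (ε | i)
    · by_cases hε : ε = 1
      · simp [form, signOfTauZero, hε, h2]
      · simp only [form, signOfTauZero, hε, if_false, sign_eq_neg_one_iff]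
        obtain ⟨c, hc, hcx⟩ : ∃ c : ℝ, 0 < c ∧ ∀ i, c ≤ x i := by
          obtain ⟨k, _, hk⟩ := Finset.exists_min_image Finset.univ x
            ⟨(0 : Fin n), Finset.mem_univ _⟩
          exact ⟨x k, h1 k, fun i => hk i (Finset.mem_univ i)⟩
        linarith [sum_signs_add_le hε hc.le hcx]
    · simpa [form, signOfTauZero, sign_eq_one_iff] using h1 i
  · intro h
    refine ⟨fun i => ?_, ?_⟩
    · simpa [form, signOfTauZero, sign_eq_one_iff] using h (Sum.inr i)
    · have := h (Sum.inl 1)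
      simp only [form, signOfTauZero, if_true, sign_eq_zero_iff] at this
      simpa [sub_eq_zero] using this

theorem sigmaOut_eq (n : ℕ) : sigmaOut n = signCell (signOfSigmaOut n) := by
  ext x
  constructor
  · rintro ⟨h1, h2, h3⟩ (ε | i)
    · by_cases hε : ε = 1
      · simpa [form, signOfSigmaOut, hε, sign_eq_one_iff] using h2
      · simpa [form, signOfSigmaOut, hε, sign_eq_neg_one_iff] using h3 ε hε
    · simpa [form, signOfSigmaOut, sign_eq_one_iff] using h1 i
  · intro h
    refine ⟨fun i => ?_, ?_, fun ε hε => ?_⟩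
    · simpa [form, signOfSigmaOut, sign_eq_one_iff] using h (Sum.inr i)
    · simpa [form, signOfSigmaOut, sign_eq_one_iff] using h (Sum.inl 1)
    · simpa [form, signOfSigmaOut, hε, sign_eq_neg_one_iff] using h (Sum.inl ε)

theorem tauCoord_eq {n : ℕ} (i : Fin n) : tauCoord i = signCell (signOfTauCoord i) := by
  ext x
  constructor
  · rintro ⟨h1, h2, h3⟩ (ε | j)
    · simp only [form, signOfTauCoord, sign_eq_neg_one_iff]
      have h4 : ∀ j, 0 ≤ x j := fun j => by
        by_cases hj : j = i
        · rw [hj, h3]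
        · exact (h1 j hj).le
      linarith [sum_signs_le ε h4]
    · by_cases hj : j = i
      · simp [form, signOfTauCoord, hj, h3]
      · simpa [form, signOfTauCoord, hj, sign_eq_one_iff] using h1 j hj
  · intro h
    refine ⟨fun j hj => ?_, ?_, ?_⟩
    · simpa [form, signOfTauCoord, hj, sign_eq_one_iff] using h (Sum.inr j)
    · simpa [form, signOfTauCoord, sign_eq_neg_one_iff] using h (Sum.inl 1)
    · simpa [form, signOfTauCoord] using h (Sum.inr i)

theorem signAct_signAct {n : ℕ} (g : Fin n → ℤˣ) (x : Fin n → ℝ) :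
    signAct g (signAct g x) = x := by
  funext i
  simp only [signAct, ← mul_assoc, unit_mul_self, one_mul]

theorem form_inl_signAct {n : ℕ} (ε g : Fin n → ℤˣ) (x : Fin n → ℝ) :
    form (Sum.inl ε) (signAct g x) = form (Sum.inl (ε * g)) x := by
  simp [form, signAct, mul_assoc]

theorem sigmaReflected_eq {n : ℕ} (i : Fin n) :
    sigmaReflected i = signCell (signOfSigmaReflected i) := by
  have h0 : ∀ x, x ∈ sigmaReflected i ↔ signAct (reflection i) x ∈ sigmaZero n := by
    intro x
    constructor
    · rintro ⟨y, hy, rfl⟩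
      rwa [signAct_signAct]
    · intro h
      exact ⟨_, h, signAct_signAct _ _⟩
  have h1 : ∀ (x : Fin n → ℝ) (j : Fin n),
      signAct (reflection i) x j = if j = i then - x j else x j := by
    intro x j
    by_cases hj : j = i
    · subst hj; simp [signAct, reflection]
    · simp [signAct, reflection, hj]
  ext x
  rw [h0, sigmaZero_eq]
  constructor
  · rintro h (ε | j)
    · have := h (Sum.inl (ε * reflection i))
      rw [form_inl_signAct, mul_assoc] at this
      have h2 : reflection i * reflection i = 1 := by
        funext j; exact Int.units_mul_self _
      rw [h2, mul_one] at this
      simpa [signOfSigmaReflected, signOfSigmaZero] using this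
    · have := h (Sum.inr j)
      by_cases hj : j = i
      · simpa [form, h1, hj, signOfSigmaReflected, signOfSigmaZero, sign_eq_neg_one_iff,
          sign_eq_one_iff] using this
      · simpa [form, h1, hj, signOfSigmaReflected, signOfSigmaZero] using this
  · rintro h (ε | j)
    · rw [form_inl_signAct]
      exact h (Sum.inl (ε * reflection i))
    · have := h (Sum.inr j)
      by_cases hj : j = i
      · simpa [form, h1, hj, signOfSigmaReflected, signOfSigmaZero, sign_eq_neg_one_iff,
          sign_eq_one_iff] using this
      · simpa [form, h1, hj, signOfSigmaReflected, signOfSigmaZero] using this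

theorem sigmaZero_nonempty (n : ℕ) : (sigmaZero n).Nonempty := by
  refine ⟨fun _ => 1 / ((n : ℝ) + 1), fun _ => by positivity, ?_⟩
  simp only [Finset.sum_const, Finset.card_univ, Fintype.card_fin, nsmul_eq_mul]
  rw [mul_one_div, div_lt_one (by positivity)]
  linarith

theorem tauZero_nonempty (n : ℕ) [NeZero n] : (tauZero n).Nonempty := by
  have hn : (0 : ℝ) < n := by exact_mod_cast Nat.pos_of_ne_zero (NeZero.ne n)
  refine ⟨fun _ => 1 / (n : ℝ), fun _ => by positivity, ?_⟩
  simp only [Finset.sum_const, Finset.card_univ, Fintype.card_fin, nsmul_eq_mul]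
  field_simp

theorem sigmaOut_nonempty (n : ℕ) [NeZero n] : (sigmaOut n).Nonempty := by
  have hn : (1 : ℝ) ≤ n := by exact_mod_cast Nat.pos_of_ne_zero (NeZero.ne n)
  have hpos : (0 : ℝ) < (n : ℝ) - 1 / 2 := by linarith
  have hsum : ∑ _i : Fin n, 1 / ((n : ℝ) - 1 / 2) = n / ((n : ℝ) - 1 / 2) := by
    simp only [Finset.sum_const, Finset.card_univ, Fintype.card_fin, nsmul_eq_mul]
    rw [mul_one_div]
  refine ⟨fun _ => 1 / ((n : ℝ) - 1 / 2), fun _ => by positivity, ?_, fun ε hε => ?_⟩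
  · rw [hsum, lt_div_iff₀ hpos]; linarith
  · have h1 := sum_signs_add_le (x := fun _ => 1 / ((n : ℝ) - 1 / 2)) hε
      (one_div_pos.2 hpos).le (fun _ => le_rfl)
    rw [hsum] at h1
    have h2 : (n : ℝ) / ((n : ℝ) - 1 / 2) - 2 * (1 / ((n : ℝ) - 1 / 2)) < 1 := by
      rw [mul_one_div, ← sub_div, div_lt_one hpos]; linarith
    linarith

theorem tauCoord_nonempty {n : ℕ} (i : Fin n) : (tauCoord i).Nonempty := by
  obtain ⟨x, hx1, hx2⟩ := sigmaZero_nonempty n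
  refine ⟨Function.update x i 0, fun j hj => ?_, ?_, by simp⟩
  · simpa [hj] using hx1 j
  · refine lt_of_le_of_lt (Finset.sum_le_sum fun j _ => ?_) hx2
    by_cases hj : j = i
    · subst hj; simpa using (hx1 j).le
    · simp [hj]

theorem isChamber_sigmaZero (n : ℕ) : IsChamber 0 (sigmaZero n) := by
  have h := sigmaZero_nonempty n
  rw [sigmaZero_eq] at h ⊢
  exact isChamber_zero_signCell h (by rintro (_ | _) <;> simp [signOfSigmaZero])

theorem isChamber_sigmaOut (n : ℕ) [NeZero n] : IsChamber 0 (sigmaOut n) := by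
  have h := sigmaOut_nonempty n
  rw [sigmaOut_eq] at h ⊢
  refine isChamber_zero_signCell h ?_
  rintro (ε | _)
  · by_cases hε : ε = 1 <;> simp [signOfSigmaOut, hε]
  · simp [signOfSigmaOut]

theorem isChamber_sigmaReflected {n : ℕ} (i : Fin n) : IsChamber 0 (sigmaReflected i) := by
  have h : (sigmaReflected i).Nonempty := (sigmaZero_nonempty n).image _
  rw [sigmaReflected_eq] at h ⊢
  refine isChamber_zero_signCell h ?_
  rintro (_ | j)
  · simp [signOfSigmaReflected]
  · by_cases hj : j = i <;> simp [signOfSigmaReflected, hj]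

theorem isChamber_tauZero (n : ℕ) [NeZero n] : IsChamber 1 (tauZero n) := by
  have h := tauZero_nonempty n
  obtain ⟨x, hx⟩ := tauZero_nonempty n
  rw [tauZero_eq] at h ⊢
  refine isChamber_signCell h ?_
  have h1 : {y : Fin n → ℝ | ∀ j, signOfTauZero n j = 0 → form j y = 0}
      = {y | (∑ i, LinearMap.proj i : (Fin n → ℝ) →ₗ[ℝ] ℝ) y = 1} := by
    ext y
    constructor
    · intro hy
      have := hy (Sum.inl 1) (by simp [signOfTauZero])
      simpa [form, sub_eq_zero] using this
    · rintro hy (ε | j) hj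
      · by_cases hε : ε = 1
        · simpa [form, sub_eq_zero, hε] using hy
        · simp [signOfTauZero, hε] at hj
      · simp [signOfTauZero] at hj
  rw [h1]
  refine finrank_levelSet _ _ (x := x) (by simpa using hx.2) fun h0 => ?_
  have := congrArg (fun l => l x) h0
  simp [hx.2] at this

theorem isChamber_tauCoord {n : ℕ} (i : Fin n) : IsChamber 1 (tauCoord i) := by
  have h := tauCoord_nonempty i
  rw [tauCoord_eq] at h ⊢
  refine isChamber_signCell h ?_
  have h1 : {y : Fin n → ℝ | ∀ j, signOfTauCoord i j = 0 → form j y = 0}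
      = {y | (LinearMap.proj i : (Fin n → ℝ) →ₗ[ℝ] ℝ) y = 0} := by
    ext y
    constructor
    · intro hy
      exact hy (Sum.inr i) (by simp [signOfTauCoord])
    · rintro hy (ε | j) hj
      · simp [signOfTauCoord] at hj
      · by_cases hji : j = i
        · subst hji; exact hy
        · simp [signOfTauCoord, hji] at hj
  rw [h1]
  refine finrank_levelSet _ _ (x := 0) (by simp) fun h0 => ?_
  have := congrArg (fun l => l (fun _ => 1)) h0
  simp at this

theorem tauZero_subset_sigmaZero (n : ℕ) [NeZero n] : tauZero n ⊆ closure (sigmaZero n) := by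
  have h := sigmaZero_nonempty n
  rw [sigmaZero_eq] at h ⊢
  rw [tauZero_eq]
  refine signCell_subset_closure h ?_
  rintro (ε | _)
  · by_cases hε : ε = 1 <;> simp [signOfTauZero, signOfSigmaZero, hε]
  · simp [signOfTauZero, signOfSigmaZero]

theorem tauZero_subset_sigmaOut (n : ℕ) [NeZero n] : tauZero n ⊆ closure (sigmaOut n) := by
  have h := sigmaOut_nonempty n
  rw [sigmaOut_eq] at h ⊢
  rw [tauZero_eq]
  refine signCell_subset_closure h ?_
  rintro (ε | _)
  · by_cases hε : ε = 1 <;> simp [signOfTauZero, signOfSigmaOut, hε]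
  · simp [signOfTauZero, signOfSigmaOut]

theorem tauCoord_subset_sigmaZero {n : ℕ} (i : Fin n) :
    tauCoord i ⊆ closure (sigmaZero n) := by
  have h := sigmaZero_nonempty n
  rw [sigmaZero_eq] at h ⊢
  rw [tauCoord_eq]
  refine signCell_subset_closure h ?_
  rintro (_ | j)
  · simp [signOfTauCoord, signOfSigmaZero]
  · by_cases hj : j = i <;> simp [signOfTauCoord, signOfSigmaZero, hj]

theorem tauCoord_subset_sigmaReflected {n : ℕ} (i : Fin n) :
    tauCoord i ⊆ closure (sigmaReflected i) := by
  have h : (sigmaReflected i).Nonempty := (sigmaZero_nonempty n).image _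
  rw [sigmaReflected_eq] at h ⊢
  rw [tauCoord_eq]
  refine signCell_subset_closure h ?_
  rintro (_ | j)
  · simp [signOfTauCoord, signOfSigmaReflected]
  · by_cases hj : j = i <;> simp [signOfTauCoord, signOfSigmaReflected, hj]

/-! ### Stable choices of vertices exist -/

theorem IsChamber.sign_eq {n k : ℕ} {C : Set (Fin n → ℝ)} (h : IsChamber k C)
    {x y : Fin n → ℝ} (hx : x ∈ C) (hy : y ∈ C) (i : Fin n) :
    SignType.sign (x i) = SignType.sign (y i) := by
  obtain ⟨L, hL, -, z, hz, rfl⟩ := h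
  have hK : IsPreconnected (connectedComponentIn (openPart L) z) :=
    isPreconnected_connectedComponentIn
  have hKsub := connectedComponentIn_subset (openPart L) z
  by_cases hLi : L ⊆ hypCoord i
  · have h1 : x i = 0 := hLi (hKsub hx).1
    have h2 : y i = 0 := hLi (hKsub hy).1
    rw [h1, h2]
  have hnz : ∀ w ∈ connectedComponentIn (openPart L) z, w i ≠ 0 := by
    intro w hw hw0
    have hwo := hKsub hw
    refine hwo.2 ⟨L ∩ hypCoord i, ⟨⟨⟨w, hwo.1, hw0⟩, ?_⟩, ?_⟩, hwo.1, hw0⟩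
    · obtain ⟨_, B, hB, hBe⟩ := hL
      refine ⟨insert (hypCoord i) B, insert_subset (Or.inr ⟨i, rfl⟩) hB, ?_⟩
      rw [sInter_insert, inter_comm, hBe]
    · refine ssubset_of_subset_of_ne inter_subset_left fun he => hLi ?_
      rw [← he]; exact inter_subset_right
  have hc : ContinuousOn (fun w : Fin n → ℝ => w i) (connectedComponentIn (openPart L) z) :=
    (continuous_apply i).continuousOn
  rcases lt_or_gt_of_ne (hnz x hx) with h1 | h1 <;> rcases lt_or_gt_of_ne (hnz y hy) with h2 | h2
  · rw [sign_neg h1, sign_neg h2]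
  · obtain ⟨w, hw, hw0⟩ := hK.intermediate_value hx hy hc ⟨h1.le, h2.le⟩
    exact (hnz w hw hw0).elim
  · obtain ⟨w, hw, hw0⟩ := hK.intermediate_value hy hx hc ⟨h2.le, h1.le⟩
    exact (hnz w hw hw0).elim
  · rw [sign_pos h1, sign_pos h2]

theorem IsChamber.eq_of_abs_eq {n k : ℕ} {C : Set (Fin n → ℝ)} (h : IsChamber k C)
    {x y : Fin n → ℝ} (hx : x ∈ C) (hy : y ∈ C) (hxy : |x| = |y|) : x = y := by
  funext i
  have h1 : |x i| = |y i| := congrFun hxy i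
  rw [← sign_mul_abs (x i), ← sign_mul_abs (y i), h.sign_eq hx hy i, h1]

theorem abs_signAct {n : ℕ} (g : Fin n → ℤˣ) (x : Fin n → ℝ) : |signAct g x| = |x| := by
  funext i
  simp only [Pi.abs_apply, signAct, abs_mul]
  rcases unit_cases (g i) with h | h <;> simp [h]

instance (n : ℕ) : Nonempty (VertexChoice n) := by
  classical
  -- the point of `C` is determined by its absolute value, chosen in the image of `C`
  have hex : ∀ C : Set (Fin n → ℝ), ∃ x, C.Nonempty →
      x ∈ C ∧ |x| = if h : (abs '' C).Nonempty then h.some else 0 := by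
    intro C
    by_cases hC : C.Nonempty
    · have h : (abs '' C).Nonempty := hC.image _
      obtain ⟨x, hx, hx'⟩ := h.some_mem
      exact ⟨x, fun _ => ⟨hx, by rw [hx', dif_pos h]⟩⟩
    · exact ⟨0, fun h => (hC h).elim⟩
  have hne : ∀ {k : ℕ} {C : Set (Fin n → ℝ)}, IsChamber k C → C.Nonempty := by
    rintro k C ⟨L, -, -, x, hx, rfl⟩
    exact ⟨x, mem_connectedComponentIn hx⟩
  choose f hf using hex
  refine ⟨⟨f, fun k C h => (hf C (hne h)).1, fun k C g h => ?_⟩⟩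
  have h1 := hf C (hne h)
  have h2 := hf (signAct g '' C) ((hne h).image _)
  have himg : abs '' (signAct g '' C) = abs '' C := by
    rw [image_image]; simp only [abs_signAct]
  obtain ⟨y, hy, hyf⟩ := h2.1
  rw [← hyf]
  refine congrArg _ (h.eq_of_abs_eq hy h1.1 ?_)
  rw [← abs_signAct g y, hyf, h2.2, h1.2]
  simp only [himg]

/-! ### The fundamental group -/

/-- The point `s` to which the spanning complex is contracted. -/
def basePoint {n : ℕ} (v : VertexChoice n) : XBarS v :=
  toXBarS v (vertex v (sigmaZero n) (isChamber_sigmaZero n))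

/-- The fundamental group of `X` at `x` in which a product `a * b` is the concatenation "first
`a`, then `b`".  (Mathlib's `FundamentalGroup` has the opposite multiplication.) -/
abbrev PiOne (X : Type) [TopologicalSpace X] (x : X) : Type :=
  (FundamentalGroup X x)ᵐᵒᵖ

/-- The class of a loop. -/
def PiOne.mk {X : Type} [TopologicalSpace X] {x : X} (p : Path x x) : PiOne X x :=
  MulOpposite.op (FundamentalGroup.fromPath (Path.Homotopic.Quotient.mk p))

theorem PiOne.mk_mul_mk {X : Type} [TopologicalSpace X] {x : X} (p q : Path x x) :
    PiOne.mk p * PiOne.mk q = PiOne.mk (p.trans q) := rfl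

/-- The element of the fundamental group defined by a `1`-cell: all the vertices are
contracted to the base point, so that the arrow becomes a loop. -/
noncomputable def Arrow.loop {n : ℕ} (v : VertexChoice n) (a : Arrow n) :
    PiOne (XBarS v) (basePoint v) :=
  PiOne.mk ((((a.path v).map (continuous_sigmaMk (σ := fun c : Cell n =>
      dualCell v c.codim c.face) (i := a.cell))).map (continuous_toXBarS v)).cast
    (a.toXBarS_eq v a.isChamber_source (isChamber_sigmaZero n) a.face_subset_source _)
    (a.toXBarS_eq v a.isChamber_target (isChamber_sigmaZero n) a.face_subset_target _))

/-- The arrow across `tauZero` towards the origin.  (The `1`-cell in the other direction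
is spanning, hence contracted.) -/
def arrowZero (n : ℕ) [NeZero n] : Arrow n where
  source := sigmaOut n
  face := tauZero n
  target := sigmaZero n
  isChamber_source := isChamber_sigmaOut n
  isChamber_face := isChamber_tauZero n
  isChamber_target := isChamber_sigmaZero n
  face_subset_source := tauZero_subset_sigmaOut n
  face_subset_target := tauZero_subset_sigmaZero n
  source_ne_target h := by
    obtain ⟨x, hx⟩ := sigmaOut_nonempty n
    have h1 := hx.2.1
    rw [h] at hx
    linarith [hx.2]

/-- The arrow from `sigmaZero` across `tauCoord i`. -/
def arrowCoord {n : ℕ} (i : Fin n) : Arrow n where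
  source := sigmaZero n
  face := tauCoord i
  target := sigmaReflected i
  isChamber_source := isChamber_sigmaZero n
  isChamber_face := isChamber_tauCoord i
  isChamber_target := isChamber_sigmaReflected i
  face_subset_source := tauCoord_subset_sigmaZero i
  face_subset_target := tauCoord_subset_sigmaReflected i
  source_ne_target h := by
    obtain ⟨x, hx⟩ := sigmaZero_nonempty n
    have h1 := hx.1 i
    rw [h, sigmaReflected_eq] at hx
    have h2 := hx (Sum.inr i)
    simp only [form, signOfSigmaReflected, if_true, sign_eq_neg_one_iff] at h2
    linarith

/-- `γ₀`. -/
noncomputable def gammaZero {n : ℕ} [NeZero n] (v : VertexChoice n) :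
    PiOne (XBarS v) (basePoint v) :=
  (arrowZero n).loop v

/-- `γᵢ` for `1 ≤ i ≤ n`. -/
noncomputable def gamma {n : ℕ} (v : VertexChoice n) (i : Fin n) :
    PiOne (XBarS v) (basePoint v) :=
  (arrowCoord i).loop v

/-- The product of the `γᵢ` along a list of indices. -/
noncomputable def gammaProd {n : ℕ} (v : VertexChoice n) (l : List (Fin n)) :
    PiOne (XBarS v) (basePoint v) :=
  (l.map (gamma v)).prod

end LauricellaFC

/-!
Every arrow that crosses a hyperplane `H_ε` inside the positive orthant away from the origin lies in
the spanning complex, hence has a trivial loop, and loops of arrows are invariant under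
`{1,-1}ⁿ`. All other relations used here come from the `2`-cells: a closed `2`-cell is star-shaped,
hence simply connected, so the loops of the arrows in its boundary have a potential
(`exists_potential`), and two galleries around an `(n - 2)`-chamber that start in the same chamber
and end in the opposite one give the same product.

Around a face in exactly two hyperplanes `H_ε`, `H_ε'` of the positive orthant this gives
(`wallLoop_of_two_hyperplanes`) that the loop across `H_ε` towards the origin does not change when
`H_ε'` is crossed, and that the two loops commute. Around a face in `H_ε`, `H_ε'` and `L_m`, where
`ε'` differs from `ε` just by `ε_m = 1`, `ε'_m = -1`, the galleries through the six chambers give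
(`wallLoop_of_three_hyperplanes`) that the loop across `L_m` does not change when `H_ε` and `H_ε'`
are crossed, and that it conjugates the loop across `H_ε` into the one across `H_ε'`.

Since the part of a hyperplane in the (closed) positive orthant is convex, any two of its walls are
joined by a segment in general position, which meets just faces of these two kinds
(`eq_of_forall_codim_two`). So the inward loop across `H_ε` depends on `ε` only, and the loop across
`L_m` is always `γ_m`. Starting from `γ₀`, the inward loop for `ε = 1`, and changing one sign at a
time in the given order, the inward loop across `H_ε` is `m_ε⁻¹ γ₀ m_ε` (`wallLoop_eq_conj`); the
intermediate hyperplanes all meet the positive orthant because `ε` does not have all signs `-1`.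
The loops for `ε` and `ε'` commute by the relation around a face in `H_ε ∩ H_ε'`; for `ε = ε'` they
are equal.
-/

namespace LauricellaFC

/-! ### Loops obtained by pushing paths forward -/

section PushLoop

variable {X : Type} [TopologicalSpace X] {x₀ : X}

/-- The class of the image of a path `p` under a continuous map that sends both end points of `p`
to the base point. -/
def pushLoop {Y : Type*} [TopologicalSpace Y] {f : Y → X} (hf : Continuous f) {y y' : Y}
    (p : Path y y') (h : x₀ = f y) (h' : x₀ = f y') : PiOne X x₀ :=
  PiOne.mk ((p.map hf).cast h h')

theorem pushLoop_mul {Y : Type*} [TopologicalSpace Y] {f : Y → X} (hf : Continuous f)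
    {y y' y'' : Y} (p : Path y y') (q : Path y' y'') (h : x₀ = f y) (h' : x₀ = f y')
    (h'' : x₀ = f y'') :
    pushLoop hf p h h' * pushLoop hf q h' h'' = pushLoop hf (p.trans q) h h'' := by
  subst h
  unfold pushLoop
  rw [PiOne.mk_mul_mk]
  congr 1
  ext t
  simp [Path.trans_apply]

theorem pushLoop_eq_of_homotopic {Y : Type*} [TopologicalSpace Y] {f : Y → X} (hf : Continuous f)
    {y y' : Y} {p q : Path y y'} (hpq : p.Homotopic q) (h : x₀ = f y) (h' : x₀ = f y') :
    pushLoop hf p h h' = pushLoop hf q h h' := by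
  have h1 : ((p.map hf).cast h h').Homotopic ((q.map hf).cast h h') := by
    obtain ⟨F⟩ := hpq.map ⟨f, hf⟩
    exact ⟨F.cast (by rfl) (by rfl)⟩
  unfold pushLoop PiOne.mk
  rw [Path.Homotopic.Quotient.eq.2 h1]

theorem pushLoop_congr {Y Z : Type*} [TopologicalSpace Y] [TopologicalSpace Z] {f : Y → X}
    {f' : Z → X} (hf : Continuous f) (hf' : Continuous f') {y y' : Y} {z z' : Z}
    (p : Path y y') (q : Path z z') (h : x₀ = f y) (h' : x₀ = f y') (k : x₀ = f' z)
    (k' : x₀ = f' z') (hpq : ∀ t, f (p t) = f' (q t)) :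
    pushLoop hf p h h' = pushLoop hf' q k k' := by
  unfold pushLoop
  congr 1
  ext t
  exact hpq t

theorem pushLoop_eq_one {Y : Type*} [TopologicalSpace Y] {f : Y → X} (hf : Continuous f)
    {y y' : Y} (p : Path y y') (h : x₀ = f y) (h' : x₀ = f y') (hp : ∀ t, f (p t) = x₀) :
    pushLoop hf p h h' = 1 := by
  have h1 : (p.map hf).cast h h' = Path.refl x₀ := by
    ext t; exact hp t
  unfold pushLoop
  rw [h1]
  rfl

end PushLoop

/-! ### Loops of arrows -/

/-- The closed cell of index `c`, mapped to the contracted complex. -/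
def cellMap {n : ℕ} (v : VertexChoice n) (c : Cell n) (x : dualCell v c.codim c.face) : XBarS v :=
  toXBarS v ⟨c, x⟩

theorem continuous_cellMap {n : ℕ} (v : VertexChoice n) (c : Cell n) :
    Continuous (cellMap v c) :=
  (continuous_toXBarS v).comp
    (continuous_sigmaMk (σ := fun c : Cell n => dualCell v c.codim c.face) (i := c))

theorem Arrow.basePoint_eq_source {n : ℕ} (v : VertexChoice n) (a : Arrow n) :
    basePoint v = cellMap v a.cell
      ⟨v.pt a.source, a.segment_source_subset v (left_mem_segment ℝ _ _)⟩ :=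
  a.toXBarS_eq v a.isChamber_source (isChamber_sigmaZero n) a.face_subset_source _

theorem Arrow.basePoint_eq_target {n : ℕ} (v : VertexChoice n) (a : Arrow n) :
    basePoint v = cellMap v a.cell
      ⟨v.pt a.target, a.segment_target_subset v (left_mem_segment ℝ _ _)⟩ :=
  a.toXBarS_eq v a.isChamber_target (isChamber_sigmaZero n) a.face_subset_target _

theorem Arrow.loop_eq_pushLoop {n : ℕ} (v : VertexChoice n) (a : Arrow n) :
    a.loop v = pushLoop (continuous_cellMap v a.cell) (a.path v)
      (a.basePoint_eq_source v) (a.basePoint_eq_target v) := rfl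

/-- The spanning complex is contracted, hence so are the arrows in it. -/
theorem Arrow.loop_eq_one_of_isSpanningOne {n : ℕ} (v : VertexChoice n) (a : Arrow n)
    (h : a.cell.IsSpanningOne v) : a.loop v = 1 := by
  rw [a.loop_eq_pushLoop]
  refine pushLoop_eq_one _ _ _ _ fun t => Quot.sound ?_
  exact ⟨⟨_, rfl, Or.inr (Or.inl h)⟩, ⟨_, rfl, Or.inl rfl⟩⟩

theorem signAct_lineMap {n : ℕ} (g : Fin n → ℤˣ) (x y : Fin n → ℝ) (t : ℝ) :
    signAct g (AffineMap.lineMap x y t) = AffineMap.lineMap (signAct g x) (signAct g y) t := by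
  funext i
  simp [signAct, AffineMap.lineMap_apply]
  ring

theorem segmentPath_trans_symm_apply_coe {n : ℕ} {S : Set (Fin n → ℝ)} {x y z : Fin n → ℝ}
    (h : segment ℝ x y ⊆ S) (h' : segment ℝ z y ⊆ S) (t : unitInterval) :
    ((segmentPath h).trans (segmentPath h').symm t : Fin n → ℝ) = if (t : ℝ) ≤ 1 / 2
      then AffineMap.lineMap x y (2 * (t : ℝ))
      else AffineMap.lineMap z y (1 - (2 * (t : ℝ) - 1)) := by
  rw [Path.trans_apply]
  split_ifs with h <;> rfl

theorem Arrow.path_apply_coe {n : ℕ} (v : VertexChoice n) (a : Arrow n) (t : unitInterval) :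
    (a.path v t : Fin n → ℝ) = if (t : ℝ) ≤ 1 / 2
      then AffineMap.lineMap (v.pt a.source) (v.pt a.face) (2 * (t : ℝ))
      else AffineMap.lineMap (v.pt a.target) (v.pt a.face) (1 - (2 * (t : ℝ) - 1)) :=
  segmentPath_trans_symm_apply_coe _ _ t

theorem Arrow.loop_signAct {n : ℕ} (v : VertexChoice n) (a b : Arrow n) (g : Fin n → ℤˣ)
    (hs : b.source = signAct g '' a.source) (hf : b.face = signAct g '' a.face)
    (ht : b.target = signAct g '' a.target) : b.loop v = a.loop v := by
  rw [a.loop_eq_pushLoop, b.loop_eq_pushLoop]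
  refine pushLoop_congr _ _ _ _ _ _ _ _ fun t => ?_
  refine (congrArg (Quot.mk _) (Quot.sound (r := OrbitRel v) ?_)).symm
  refine ⟨g, _, _, rfl, rfl, hs, hf, ?_⟩
  change (b.path v t : Fin n → ℝ) = signAct g (a.path v t : Fin n → ℝ)
  rw [b.path_apply_coe, a.path_apply_coe, hs, hf, ht,
    v.pt_signAct 0 _ g a.isChamber_source, v.pt_signAct 1 _ g a.isChamber_face,
    v.pt_signAct 0 _ g a.isChamber_target]
  split_ifs <;> rw [signAct_lineMap]

/-! ### The relation given by a 2-cell -/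

/-- The index of the `2`-cell of `(σ, τ)`. -/
def twoCell {n : ℕ} {σ τ : Set (Fin n → ℝ)} (hσ : IsChamber 0 σ) (hτ : IsChamber 2 τ)
    (h : τ ⊆ closure σ) : Cell n where
  codim := 2
  codim_le := le_rfl
  chamber := σ
  face := τ
  isChamber_chamber := hσ
  isChamber_face := hτ
  face_subset := h

theorem starConvex_dualCell_two {n : ℕ} (v : VertexChoice n) (τ : Set (Fin n → ℝ)) :
    StarConvex ℝ (v.pt τ) (dualCell v 2 τ) := by
  rintro x ⟨σ, ρ, hσ, hρ, hρσ, hτρ, hx⟩ a b ha hb hab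
  refine ⟨σ, ρ, hσ, hρ, hρσ, hτρ, ?_⟩
  exact convex_convexHull ℝ _ (subset_convexHull ℝ _ (by simp)) hx ha hb hab

theorem dualCell_one_subset {n : ℕ} (v : VertexChoice n) {τ ρ : Set (Fin n → ℝ)}
    (hρ : IsChamber 1 ρ) (h : τ ⊆ closure ρ) : dualCell v 1 ρ ⊆ dualCell v 2 τ := by
  rintro x ⟨σ, hσ, hρσ, hx⟩
  refine ⟨σ, ρ, hσ, hρ, hρσ, h, ?_⟩
  exact (convex_convexHull ℝ _).segment_subset (subset_convexHull ℝ _ (by simp))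
    (subset_convexHull ℝ _ (by simp)) hx

/-- The arrow `a` is attached to the boundary of the `2`-cell of `(σ, τ)`: its face is adjacent to
`τ` and its source lies on the same side of the face as `σ`. -/
def Arrow.InBoundary {n : ℕ} (v : VertexChoice n) (a : Arrow n) (σ τ : Set (Fin n → ℝ)) : Prop :=
  τ ⊆ closure a.face ∧
    ∀ H ∈ arrangement n, a.face ⊆ H → ¬ Separates H (v.pt σ) (v.pt a.source)

/-- The closed `2`-cell of `(σ, τ)` is star-shaped, hence simply connected. Therefore the loops of
the arrows in its boundary have a potential: along a gallery around `τ` their product depends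
only on the end chambers. -/
theorem exists_potential {n : ℕ} (v : VertexChoice n) {σ τ : Set (Fin n → ℝ)}
    (hσ : IsChamber 0 σ) (hτ : IsChamber 2 τ) (h : τ ⊆ closure σ) :
    ∃ e : Set (Fin n → ℝ) → PiOne (XBarS v) (basePoint v),
      ∀ a : Arrow n, a.InBoundary v σ τ → a.loop v = (e a.source)⁻¹ * e a.target := by
  classical
  by_cases hex : ∃ a : Arrow n, a.InBoundary v σ τ
  swap
  · exact ⟨1, fun a ha => (hex ⟨a, ha⟩).elim⟩
  let c := twoCell hσ hτ h
  have hmem : ∀ a : Arrow n, a.InBoundary v σ τ →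
      dualCell v 1 a.face ⊆ dualCell v c.codim c.face :=
    fun a ha => dualCell_one_subset v a.isChamber_face ha.1
  have hglue : ∀ (a : Arrow n) (ha : a.InBoundary v σ τ) (x : dualCell v 1 a.face),
      cellMap v c ⟨x, hmem a ha x.2⟩ = cellMap v a.cell x := fun a ha x =>
    congrArg (fun z => Quot.mk _ (Quot.mk _ z)) (Quot.sound ⟨ha.1, rfl, ha.2⟩)
  have hsrc : ∀ (a : Arrow n), v.pt a.source ∈ dualCell v 1 a.face := fun a =>
    a.segment_source_subset v (left_mem_segment ℝ _ _)
  have htgt : ∀ (a : Arrow n), v.pt a.target ∈ dualCell v 1 a.face := fun a =>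
    a.segment_target_subset v (left_mem_segment ℝ _ _)
  obtain ⟨a₀, ha₀⟩ := hex
  have : ContractibleSpace (dualCell v c.codim c.face) :=
    (starConvex_dualCell_two v τ).contractibleSpace ⟨_, hmem a₀ ha₀ (hsrc a₀)⟩
  let y₀ : dualCell v c.codim c.face := ⟨v.pt a₀.source, hmem a₀ ha₀ (hsrc a₀)⟩
  have hy₀ : basePoint v = cellMap v c y₀ :=
    (a₀.basePoint_eq_source v).trans (hglue a₀ ha₀ ⟨_, hsrc a₀⟩).symm
  let e : Set (Fin n → ℝ) → PiOne (XBarS v) (basePoint v) := fun ρ =>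
    if hρ : ∃ hm : v.pt ρ ∈ dualCell v c.codim c.face, basePoint v = cellMap v c ⟨v.pt ρ, hm⟩
    then pushLoop (continuous_cellMap v c) (PathConnectedSpace.somePath y₀ ⟨v.pt ρ, hρ.1⟩) hy₀ hρ.2
    else 1
  refine ⟨e, fun a ha => ?_⟩
  have h1 : ∃ hm : v.pt a.source ∈ dualCell v c.codim c.face,
      basePoint v = cellMap v c ⟨v.pt a.source, hm⟩ :=
    ⟨hmem a ha (hsrc a), (a.basePoint_eq_source v).trans (hglue a ha ⟨_, hsrc a⟩).symm⟩
  have h2 : ∃ hm : v.pt a.target ∈ dualCell v c.codim c.face,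
      basePoint v = cellMap v c ⟨v.pt a.target, hm⟩ :=
    ⟨hmem a ha (htgt a), (a.basePoint_eq_target v).trans (hglue a ha ⟨_, htgt a⟩).symm⟩
  -- the path of `a`, seen in the closed `2`-cell
  let p : Path (⟨v.pt a.source, h1.1⟩ : dualCell v c.codim c.face) ⟨v.pt a.target, h2.1⟩ :=
    (a.path v).map (f := Set.inclusion (hmem a ha)) (continuous_inclusion _)
  have h3 : a.loop v = pushLoop (continuous_cellMap v c) p h1.2 h2.2 := by
    rw [a.loop_eq_pushLoop]
    exact pushLoop_congr _ _ _ _ _ _ _ _ fun t => (hglue a ha (a.path v t)).symm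
  rw [eq_inv_mul_iff_mul_eq, h3]
  simp only [e, dif_pos h1, dif_pos h2]
  rw [pushLoop_mul]
  exact pushLoop_eq_of_homotopic _ (SimplyConnectedSpace.paths_homotopic _ _) _ _

/-! ### Sign vectors -/

section SignVectors

variable {n : ℕ}

/-- The linear part of the affine form `form j`. -/
def linForm : (Fin n → ℤˣ) ⊕ Fin n → (Fin n → ℝ) →ₗ[ℝ] ℝ
  | Sum.inl ε => ∑ i, ((ε i : ℤ) : ℝ) • LinearMap.proj i
  | Sum.inr i => LinearMap.proj i

theorem linForm_inl_apply (ε : Fin n → ℤˣ) (u : Fin n → ℝ) :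
    linForm (Sum.inl ε) u = ∑ i, ((ε i : ℤ) : ℝ) * u i := by
  simp [linForm]

theorem linForm_inr_apply (i : Fin n) (u : Fin n → ℝ) : linForm (Sum.inr i) u = u i := rfl

theorem form_inl_eq (ε : Fin n → ℤˣ) (x : Fin n → ℝ) :
    form (Sum.inl ε) x = linForm (Sum.inl ε) x - 1 := by
  simp [form, linForm]

theorem form_add_smul (j : (Fin n → ℤˣ) ⊕ Fin n) (x u : Fin n → ℝ) (δ : ℝ) :
    form j (x + δ • u) = form j x + δ * linForm j u := by
  cases j with
  | inl ε => rw [form_inl_eq, form_inl_eq, map_add, map_smul, smul_eq_mul]; ring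
  | inr i => simp [form, linForm]

theorem exists_linForm_eq_one [NeZero n] (j : (Fin n → ℤˣ) ⊕ Fin n) :
    ∃ u, linForm j u = 1 := by
  cases j with
  | inl ε =>
    refine ⟨Pi.single 0 ((ε 0 : ℤ) : ℝ), ?_⟩
    rw [linForm_inl_apply]
    simp [Pi.single_apply, unit_mul_self]
  | inr i => exact ⟨fun _ => 1, rfl⟩

/-- The sign vector of a point. -/
noncomputable def signAt (x : Fin n → ℝ) (j : (Fin n → ℤˣ) ⊕ Fin n) : SignType :=
  SignType.sign (form j x)

theorem mem_signCell_signAt (x : Fin n → ℝ) : x ∈ signCell (signAt x) := fun _ => rfl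

theorem signAt_eq_of_mem {x : Fin n → ℝ} {s : (Fin n → ℤˣ) ⊕ Fin n → SignType}
    (hx : x ∈ signCell s) : signAt x = s := funext hx

theorem signAt_eq_zero {x : Fin n → ℝ} {j : (Fin n → ℤˣ) ⊕ Fin n} :
    signAt x j = 0 ↔ form j x = 0 := sign_eq_zero_iff

/-- Forms that do not vanish at `x` keep their signs near `x`. -/
theorem eventually_signAt_eq (x : Fin n → ℝ) :
    ∀ᶠ y in nhds x, ∀ j, form j x ≠ 0 → signAt y j = signAt x j := by
  rw [Filter.eventually_all]
  intro j
  rcases lt_trichotomy (form j x) 0 with h | h | h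
  · filter_upwards [(continuous_form j).continuousAt.eventually (gt_mem_nhds h)] with y hy _
    rw [signAt, signAt, sign_neg h, sign_neg hy]
  · exact Filter.Eventually.of_forall fun y hy => (hy h).elim
  · filter_upwards [(continuous_form j).continuousAt.eventually (lt_mem_nhds h)] with y hy _
    rw [signAt, signAt, sign_pos h, sign_pos hy]

/-- The sign vector of `x + δ u` for small `δ > 0` is given by the signs of the linear parts at
`u` where the sign at `x` is `0`. -/
theorem signCell_nonempty_of_direction (x u : Fin n → ℝ)
    {s : (Fin n → ℤˣ) ⊕ Fin n → SignType} (h0 : ∀ j, form j x ≠ 0 → s j = signAt x j)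
    (h1 : ∀ j, form j x = 0 → s j = SignType.sign (linForm j u)) : (signCell s).Nonempty := by
  have hc : Filter.Tendsto (fun δ : ℝ => x + δ • u) (nhdsWithin 0 (Ioi 0)) (nhds x) := by
    have : Continuous fun δ : ℝ => x + δ • u := by fun_prop
    have h := this.tendsto 0
    simp only [zero_smul, add_zero] at h
    exact h.mono_left nhdsWithin_le_nhds
  obtain ⟨δ, hδ, hδ0⟩ := ((hc.eventually (eventually_signAt_eq x)).and
    self_mem_nhdsWithin).exists
  have hδ0' : 0 < δ := hδ0
  refine ⟨x + δ • u, fun j => ?_⟩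
  by_cases hj : form j x = 0
  · rw [h1 j hj, form_add_smul, hj, zero_add, sign_mul, sign_pos hδ0', one_mul]
  · rw [h0 j hj, ← hδ j hj]; rfl

/-- Nonempty sign cells on which exactly one form vanishes are `(n - 1)`-chambers. -/
theorem isChamber_one_signCell [NeZero n] {s : (Fin n → ℤˣ) ⊕ Fin n → SignType}
    {j₀ : (Fin n → ℤˣ) ⊕ Fin n} (hne : (signCell s).Nonempty) (hz : ∀ j, s j = 0 ↔ j = j₀) :
    IsChamber 1 (signCell s) := by
  refine isChamber_signCell hne ?_
  obtain ⟨x, hx⟩ := hne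
  have hx0 : form j₀ x = 0 := by
    have := hx j₀
    rwa [(hz j₀).2 rfl, sign_eq_zero_iff] at this
  have h1 : {y : Fin n → ℝ | ∀ j, s j = 0 → form j y = 0}
      = {y | linForm j₀ y = linForm j₀ x} := by
    ext y
    have h2 := form_add_smul j₀ x (y - x) 1
    rw [hx0, one_smul, add_sub_cancel, map_sub] at h2
    constructor
    · intro hy
      have h3 := hy j₀ ((hz j₀).2 rfl)
      change linForm j₀ y = linForm j₀ x
      linarith
    · intro hy j hj
      have hy' : linForm j₀ y = linForm j₀ x := hy
      rw [(hz j).1 hj]; linarith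
  rw [h1]
  refine finrank_levelSet _ _ (x := x) rfl fun h0 => ?_
  obtain ⟨u, hu⟩ := exists_linForm_eq_one j₀
  rw [h0] at hu
  simp at hu

theorem signCell_update_nonempty [NeZero n] {s : (Fin n → ℤˣ) ⊕ Fin n → SignType}
    {j₀ : (Fin n → ℤˣ) ⊕ Fin n} (hne : (signCell s).Nonempty) (hz : ∀ j, s j = 0 ↔ j = j₀)
    (δ : SignType) : (signCell (Function.update s j₀ δ)).Nonempty := by
  obtain ⟨x, hx⟩ := hne
  have hs := signAt_eq_of_mem hx
  obtain ⟨u, hu⟩ := exists_linForm_eq_one j₀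
  have hδ : SignType.sign ((δ : ℤ) : ℝ) = δ := by cases δ <;> simp
  refine signCell_nonempty_of_direction x (((δ : ℤ) : ℝ) • u) (fun j hj => ?_) fun j hj => ?_
  · have : j ≠ j₀ := fun h => hj (signAt_eq_zero.1 (by rw [hs]; exact (hz j).2 h))
    rw [Function.update_of_ne this, hs]
  · have : j = j₀ := (hz j).1 (by rw [← hs]; exact signAt_eq_zero.2 hj)
    subst this
    rw [Function.update_self, map_smul, hu, smul_eq_mul, mul_one, hδ]

theorem isChamber_zero_update [NeZero n] {s : (Fin n → ℤˣ) ⊕ Fin n → SignType}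
    {j₀ : (Fin n → ℤˣ) ⊕ Fin n} (hne : (signCell s).Nonempty) (hz : ∀ j, s j = 0 ↔ j = j₀)
    {δ : SignType} (hδ : δ ≠ 0) : IsChamber 0 (signCell (Function.update s j₀ δ)) := by
  refine isChamber_zero_signCell (signCell_update_nonempty hne hz δ) fun j => ?_
  by_cases hj : j = j₀
  · subst hj; simpa using hδ
  · rw [Function.update_of_ne hj]
    exact fun h => hj ((hz j).1 h)

theorem signCell_subset_closure_update [NeZero n] {s : (Fin n → ℤˣ) ⊕ Fin n → SignType}
    {j₀ : (Fin n → ℤˣ) ⊕ Fin n} (hne : (signCell s).Nonempty) (hz : ∀ j, s j = 0 ↔ j = j₀)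
    (δ : SignType) : signCell s ⊆ closure (signCell (Function.update s j₀ δ)) := by
  refine signCell_subset_closure (signCell_update_nonempty hne hz δ) fun j => ?_
  by_cases hj : j = j₀
  · exact Or.inl ((hz j).2 hj)
  · rw [Function.update_of_ne hj]; exact Or.inr rfl

theorem neg_ne_self_of_ne_zero {δ : SignType} (hδ : δ ≠ 0) : -δ ≠ δ := by
  revert hδ; revert δ; decide

/-- The arrow that crosses the wall `signCell s`, on which only `form j₀` vanishes, to the side
where `form j₀` has the sign `δ`. -/
def wallArrow [NeZero n] {s : (Fin n → ℤˣ) ⊕ Fin n → SignType}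
    {j₀ : (Fin n → ℤˣ) ⊕ Fin n} (hne : (signCell s).Nonempty) (hz : ∀ j, s j = 0 ↔ j = j₀)
    {δ : SignType} (hδ : δ ≠ 0) : Arrow n where
  source := signCell (Function.update s j₀ (-δ))
  face := signCell s
  target := signCell (Function.update s j₀ δ)
  isChamber_source := isChamber_zero_update hne hz (by simpa using hδ)
  isChamber_face := isChamber_one_signCell hne hz
  isChamber_target := isChamber_zero_update hne hz hδ
  face_subset_source := signCell_subset_closure_update hne hz _
  face_subset_target := signCell_subset_closure_update hne hz _
  source_ne_target h := by
    obtain ⟨x, hx⟩ := signCell_update_nonempty hne hz δ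
    have h1 := hx j₀
    rw [← h] at hx
    have h2 := hx j₀
    rw [h1, Function.update_self, Function.update_self] at h2
    exact neg_ne_self_of_ne_zero hδ h2.symm

/-- The loop of the arrow that crosses the wall `signCell s` to the side where `form j₀` has the
sign `δ`; the value is `1` if there is no such arrow. -/
noncomputable def wallLoop (v : VertexChoice n) (s : (Fin n → ℤˣ) ⊕ Fin n → SignType)
    (j₀ : (Fin n → ℤˣ) ⊕ Fin n) (δ : SignType) : PiOne (XBarS v) (basePoint v) :=
  open Classical in
  if h : ∃ a : Arrow n, a.source = signCell (Function.update s j₀ (-δ)) ∧ a.face = signCell s ∧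
    a.target = signCell (Function.update s j₀ δ) then h.choose.loop v else 1

theorem Arrow.loop_eq_wallLoop (v : VertexChoice n) (a : Arrow n)
    {s : (Fin n → ℤˣ) ⊕ Fin n → SignType} {j₀ : (Fin n → ℤˣ) ⊕ Fin n} {δ : SignType}
    (hs : a.source = signCell (Function.update s j₀ (-δ))) (hf : a.face = signCell s)
    (ht : a.target = signCell (Function.update s j₀ δ)) : a.loop v = wallLoop v s j₀ δ := by
  have h : ∃ a : Arrow n, a.source = signCell (Function.update s j₀ (-δ)) ∧ a.face = signCell s ∧
    a.target = signCell (Function.update s j₀ δ) := ⟨a, hs, hf, ht⟩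
  rw [wallLoop, dif_pos h]
  congr 1
  obtain ⟨h1, h2, h3⟩ := h.choose_spec
  generalize h.choose = b at *
  cases a; cases b
  simp only at hs hf ht h1 h2 h3
  subst hs hf ht h1 h2 h3
  rfl

theorem loop_wallArrow [NeZero n] (v : VertexChoice n) {s : (Fin n → ℤˣ) ⊕ Fin n → SignType}
    {j₀ : (Fin n → ℤˣ) ⊕ Fin n} (hne : (signCell s).Nonempty) (hz : ∀ j, s j = 0 ↔ j = j₀)
    {δ : SignType} (hδ : δ ≠ 0) : (wallArrow hne hz hδ).loop v = wallLoop v s j₀ δ :=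
  Arrow.loop_eq_wallLoop v _ rfl rfl rfl

/-! ### Relations between loops of walls -/

theorem not_separates_of_signAt_eq {j : (Fin n → ℤˣ) ⊕ Fin n} {x y : Fin n → ℝ}
    (hx : signAt x j ≠ 0) (hxy : signAt x j = signAt y j) :
    ¬ Separates {z | form j z = 0} x y := by
  rintro ⟨_, ⟨a, b, ha, hb, hab, rfl⟩, hz⟩
  have hz' : form j (a • x + b • y) = 0 := hz
  rw [form_comb j x y hab] at hz'
  rcases ha.eq_or_lt with rfl | ha
  · have hb1 : b = 1 := by linarith
    rw [hb1] at hz'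
    refine hx (hxy.trans (signAt_eq_zero.2 ?_))
    linarith
  · have h1 : SignType.sign (a * form j x + b * form j y) = signAt x j :=
      sign_comb rfl (Or.inr hxy.symm) ha hb
    rw [hz', sign_zero] at h1
    exact hx h1.symm

theorem pt_signCell_mem (v : VertexChoice n) {S : (Fin n → ℤˣ) ⊕ Fin n → SignType}
    (hne : (signCell S).Nonempty) (hS : ∀ j, S j ≠ 0) : signAt (v.pt (signCell S)) = S :=
  signAt_eq_of_mem (v.pt_mem 0 _ (isChamber_zero_signCell hne hS))

/-- The relation given by the `2`-cell of `(signCell S, signCell t)`, in terms of sign vectors: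
the loops of the walls around `signCell t`, crossed away from `signCell S`, have a potential. -/
theorem exists_wallLoop_potential [NeZero n] (v : VertexChoice n)
    {t S : (Fin n → ℤˣ) ⊕ Fin n → SignType} (ht : IsChamber 2 (signCell t))
    (hSne : (signCell S).Nonempty) (hS : ∀ j, S j ≠ 0) (htS : ∀ j, t j = 0 ∨ t j = S j) :
    ∃ e : ((Fin n → ℤˣ) ⊕ Fin n → SignType) → PiOne (XBarS v) (basePoint v),
      ∀ s j₀ δ, (signCell s).Nonempty → (∀ j, s j = 0 ↔ j = j₀) → (∀ j, t j = 0 ∨ t j = s j) →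
        S j₀ = -δ → wallLoop v s j₀ δ =
          (e (Function.update s j₀ (-δ)))⁻¹ * e (Function.update s j₀ δ) := by
  obtain ⟨e, he⟩ := exists_potential v (isChamber_zero_signCell hSne hS) ht
    (signCell_subset_closure hSne htS)
  refine ⟨fun s => e (signCell s), fun s j₀ δ hne hz hts hSδ => ?_⟩
  have hδ : δ ≠ 0 := by
    rintro rfl
    exact hS j₀ (by simpa using hSδ)
  rw [← loop_wallArrow v hne hz hδ]
  refine he _ ⟨signCell_subset_closure hne hts, fun H hH hsub => ?_⟩
  obtain ⟨j, rfl⟩ := (mem_arrangement_iff H).1 hH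
  obtain ⟨y, hy⟩ := hne
  have hj : j = j₀ := (hz j).1 (by
    rw [← hy j]; exact sign_eq_zero_iff.2 (hsub hy))
  subst hj
  have h1 : signAt (v.pt (signCell S)) = S := pt_signCell_mem v hSne hS
  have h2 : signAt (v.pt (signCell (Function.update s j (-δ)))) = Function.update s j (-δ) :=
    signAt_eq_of_mem (v.pt_mem 0 _ (isChamber_zero_update ⟨y, hy⟩ hz (by simpa using hδ)))
  refine not_separates_of_signAt_eq ?_ ?_
  · rw [h1]; exact hS j
  · rw [h1]; change S j = signAt (v.pt (signCell (Function.update s j (-δ)))) j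
    rw [h2, Function.update_self, hSδ]

theorem height_signCell (v : VertexChoice n) {S : (Fin n → ℤˣ) ⊕ Fin n → SignType}
    (hne : (signCell S).Nonempty) (hS : ∀ j, S j ≠ 0) :
    height v (signCell S) = {ε : Fin n → ℤˣ | S (Sum.inl ε) = 1}.ncard := by
  unfold height
  congr 1
  ext ε
  have h1 := congrFun (pt_signCell_mem v hne hS) (Sum.inl ε)
  set x := v.pt (signCell S)
  have h0 : form (Sum.inl ε) (0 : Fin n → ℝ) = -1 := by simp [form]
  have hH : hypEps ε = {z | form (Sum.inl ε) z = 0} := by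
    ext z; simp [hypEps, form, sub_eq_zero]
  simp only [mem_ofPred_eq]
  rw [hH, ← h1]
  constructor
  · intro hsep
    by_contra hne1
    have hneg : signAt x (Sum.inl ε) = -1 := by
      have := hS (Sum.inl ε)
      rw [← h1] at this
      revert hne1 this
      generalize signAt x (Sum.inl ε) = σ
      revert σ; decide
    refine not_separates_of_signAt_eq (x := 0) ?_ ?_ hsep
    · simp [signAt, h0]
    · rw [hneg]; simp [signAt, h0]
  · intro hpos
    have hpos' : 0 < form (Sum.inl ε) x := sign_eq_one_iff.1 hpos
    -- the segment meets the hyperplane where the value of the linear part is `1`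
    set c := form (Sum.inl ε) x
    have hc : 0 < c + 1 := by linarith
    refine ⟨(c / (c + 1)) • (0 : Fin n → ℝ) + (1 / (c + 1)) • x,
      ⟨c / (c + 1), 1 / (c + 1), by positivity, by positivity, by field_simp, rfl⟩, ?_⟩
    change form (Sum.inl ε) _ = 0
    rw [form_comb _ _ _ (by field_simp), h0]
    change c / (c + 1) * -1 + 1 / (c + 1) * c = 0
    field_simp; ring

/-- Walls of the positive orthant that are crossed away from the origin give the trivial loop. -/
theorem wallLoop_outward_eq_one [NeZero n] (v : VertexChoice n)
    {s : (Fin n → ℤˣ) ⊕ Fin n → SignType} {ε : Fin n → ℤˣ} (hne : (signCell s).Nonempty)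
    (hz : ∀ j, s j = 0 ↔ j = Sum.inl ε) (hpos : ∀ i, s (Sum.inr i) = 1) :
    wallLoop v s (Sum.inl ε) 1 = 1 := by
  classical
  have h1 : (1 : SignType) ≠ 0 := by decide
  have h2 : (-1 : SignType) ≠ 0 := by decide
  rw [← loop_wallArrow v hne hz h1]
  refine Arrow.loop_eq_one_of_isSpanningOne v _ ⟨rfl, fun x hx i => ?_, ⟨ε, fun x hx => ?_⟩,
    signCell (Function.update s (Sum.inl ε) 1), isChamber_zero_update hne hz h1,
    (wallArrow hne hz h1).source_ne_target.symm, signCell_subset_closure_update hne hz _, ?_⟩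
  · have := hx (Sum.inr i)
    rw [Function.update_of_ne (by simp), hpos] at this
    exact (sign_eq_one_iff.1 this).le
  · have := hx (Sum.inl ε)
    rw [(hz _).2 rfl, sign_eq_zero_iff] at this
    simpa [form, hypEps, sub_eq_zero] using this
  · have hnz : ∀ δ : SignType, δ ≠ 0 → ∀ j, Function.update s (Sum.inl ε) δ j ≠ 0 := by
      intro δ hδ j
      by_cases hj : j = Sum.inl ε
      · subst hj; simpa using hδ
      · rw [Function.update_of_ne hj]
        exact fun h => hj ((hz j).1 h)
    change height v (signCell (Function.update s (Sum.inl ε) (-1))) + 1 = _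
    rw [height_signCell v (signCell_update_nonempty hne hz _) (hnz _ h2),
      height_signCell v (signCell_update_nonempty hne hz _) (hnz _ h1),
      ← Set.ncard_insert_of_notMem (a := ε) (by simp) (Set.toFinite _)]
    congr 1
    ext ε'
    by_cases h : ε' = ε
    · simp [h]
    · simp [h]

/-- The action of `{1,-1}ⁿ` on sign vectors. -/
noncomputable def signVecAct (g : Fin n → ℤˣ) (s : (Fin n → ℤˣ) ⊕ Fin n → SignType) :
    (Fin n → ℤˣ) ⊕ Fin n → SignType
  | Sum.inl ε => s (Sum.inl (ε * g))
  | Sum.inr i => SignType.sign ((g i : ℤ) : ℝ) * s (Sum.inr i)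

theorem units_pi_mul_self (g : Fin n → ℤˣ) : g * g = 1 := funext fun i => Int.units_mul_self (g i)

theorem signAct_mem_signCell {g : Fin n → ℤˣ} {s : (Fin n → ℤˣ) ⊕ Fin n → SignType}
    {x : Fin n → ℝ} (hx : x ∈ signCell s) : signAct g x ∈ signCell (signVecAct g s) := by
  rintro (ε | i)
  · rw [form_inl_signAct]; exact hx _
  · change SignType.sign (((g i : ℤ) : ℝ) * x i) = SignType.sign ((g i : ℤ) : ℝ) * s (Sum.inr i)
    rw [sign_mul, ← hx (Sum.inr i)]; rfl

theorem signVecAct_signVecAct (g : Fin n → ℤˣ) (s : (Fin n → ℤˣ) ⊕ Fin n → SignType) :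
    signVecAct g (signVecAct g s) = s := by
  funext j
  cases j with
  | inl ε => simp [signVecAct, mul_assoc, units_pi_mul_self]
  | inr i => rcases unit_cases (g i) with h | h <;> simp [signVecAct, h]

theorem signAct_image_signCell (g : Fin n → ℤˣ) (s : (Fin n → ℤˣ) ⊕ Fin n → SignType) :
    signAct g '' signCell s = signCell (signVecAct g s) := by
  refine Subset.antisymm ?_ fun x hx => ⟨signAct g x, ?_, signAct_signAct g x⟩
  · rintro _ ⟨x, hx, rfl⟩
    exact signAct_mem_signCell hx
  · have := signAct_mem_signCell (g := g) hx
    rwa [signVecAct_signVecAct] at this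

theorem signVecAct_update_inl (g : Fin n → ℤˣ) (s : (Fin n → ℤˣ) ⊕ Fin n → SignType)
    (ε : Fin n → ℤˣ) (δ : SignType) :
    signVecAct g (Function.update s (Sum.inl ε) δ)
      = Function.update (signVecAct g s) (Sum.inl (ε * g)) δ := by
  funext j
  cases j with
  | inl ε' =>
    by_cases h : ε' = ε * g
    · subst h
      simp [signVecAct, mul_assoc, units_pi_mul_self]
    · have h' : ε' * g ≠ ε := by
        rintro rfl
        exact h (by rw [mul_assoc, units_pi_mul_self, mul_one])
      simp [signVecAct, h, h']
  | inr i => simp [signVecAct]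

theorem wallLoop_signVecAct [NeZero n] (v : VertexChoice n) (g : Fin n → ℤˣ)
    {s : (Fin n → ℤˣ) ⊕ Fin n → SignType} {ε : Fin n → ℤˣ} (hne : (signCell s).Nonempty)
    (hz : ∀ j, s j = 0 ↔ j = Sum.inl ε) {δ : SignType} (hδ : δ ≠ 0) :
    wallLoop v (signVecAct g s) (Sum.inl (ε * g)) δ = wallLoop v s (Sum.inl ε) δ := by
  have hne' : (signCell (signVecAct g s)).Nonempty := by
    rw [← signAct_image_signCell]; exact hne.image _
  have hz' : ∀ j, signVecAct g s j = 0 ↔ j = Sum.inl (ε * g) := by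
    rintro (ε' | i)
    · simp only [signVecAct, hz, Sum.inl.injEq]
      constructor
      · rintro rfl; rw [mul_assoc, units_pi_mul_self, mul_one]
      · rintro rfl; rw [mul_assoc, units_pi_mul_self, mul_one]
    · have : s (Sum.inr i) ≠ 0 := fun h => by simpa using (hz _).1 h
      rcases unit_cases (g i) with h | h <;> simp [signVecAct, h, this]
  rw [← loop_wallArrow v hne hz hδ, ← loop_wallArrow v hne' hz' hδ]
  refine Arrow.loop_signAct v _ _ g ?_ ?_ ?_
  · change signCell _ = signAct g '' signCell _
    rw [signAct_image_signCell, signVecAct_update_inl]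
  · exact (signAct_image_signCell g s).symm
  · change signCell _ = signAct g '' signCell _
    rw [signAct_image_signCell, signVecAct_update_inl]

end SignVectors

/-! ### Relations at faces of codimension two -/

section CodimTwo

variable {n : ℕ}

/-- `s` is the sign vector of an `(n - 1)`-chamber in the zero set of `form j`. -/
structure IsWall (s : (Fin n → ℤˣ) ⊕ Fin n → SignType) (j : (Fin n → ℤˣ) ⊕ Fin n) : Prop where
  nonempty : (signCell s).Nonempty
  eq_zero_iff : ∀ j', s j' = 0 ↔ j' = j

/-- `s` is the sign vector of an `(n - 1)`-chamber in the zero set of `form j` and in the closed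
positive orthant. -/
structure IsOrthantWall (s : (Fin n → ℤˣ) ⊕ Fin n → SignType) (j : (Fin n → ℤˣ) ⊕ Fin n) : Prop
    extends IsWall s j where
  eq_one : ∀ i, Sum.inr i ≠ j → s (Sum.inr i) = 1

/-- The vector in the span of two coordinate vectors `e_k`, `e_m` at which the linear parts of
`H_ε` and `H_ε'` have the values `p` and `q`, if `ε` and `ε'` agree at `k` and differ at `m`. -/
noncomputable def direction (ε : Fin n → ℤˣ) (k m : Fin n) (p q : ℝ) : Fin n → ℝ :=
  Pi.single k (((p + q) / 2) * ((ε k : ℤ) : ℝ)) + Pi.single m (((p - q) / 2) * ((ε m : ℤ) : ℝ))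

theorem linForm_inl_single (ε : Fin n → ℤˣ) (k : Fin n) (c : ℝ) :
    linForm (Sum.inl ε) (Pi.single k c) = ((ε k : ℤ) : ℝ) * c := by
  rw [linForm_inl_apply]
  simp [Pi.single_apply]

theorem linForm_direction_left (ε : Fin n → ℤˣ) (k m : Fin n) (p q : ℝ) :
    linForm (Sum.inl ε) (direction ε k m p q) = p := by
  rw [direction, map_add, linForm_inl_single, linForm_inl_single]
  linear_combination ((p + q) / 2) * unit_mul_self (ε k) + ((p - q) / 2) * unit_mul_self (ε m)

theorem linForm_direction_right {ε ε' : Fin n → ℤˣ} {k m : Fin n} (hk : ε k = ε' k)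
    (hm : ε' m = -ε m) (p q : ℝ) :
    linForm (Sum.inl ε') (direction ε k m p q) = q := by
  rw [direction, map_add, linForm_inl_single, linForm_inl_single, ← hk, hm]
  push_cast
  linear_combination ((p + q) / 2) * unit_mul_self (ε k) - ((p - q) / 2) * unit_mul_self (ε m)

theorem direction_apply {ε ε' : Fin n → ℤˣ} {k m : Fin n} (hk : ε k = ε' k)
    (hm : ε' m = -ε m) (p q : ℝ) :
    direction ε k m p q m = ((p - q) / 2) * ((ε m : ℤ) : ℝ) := by
  have hkm : m ≠ k := by
    rintro rfl
    rw [← hk] at hm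
    rcases Int.units_eq_one_or (ε m) with h | h <;> rw [h] at hm <;> exact absurd hm (by decide)
  simp [direction, hkm]

theorem vectorSpan_preimage_singleton {E : Type*} [AddCommGroup E] [Module ℝ E]
    (l : (Fin n → ℝ) →ₗ[ℝ] E) (c : E) {x : Fin n → ℝ} (hx : l x = c) :
    vectorSpan ℝ {y | l y = c} = LinearMap.ker l := by
  apply le_antisymm
  · rw [vectorSpan_def, Submodule.span_le]
    rintro _ ⟨a, ha, b, hb, rfl⟩
    have ha' : l a = c := ha
    have hb' : l b = c := hb
    simp [ha', hb']
  · intro z hz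
    have hz' : l z = 0 := hz
    have : (z + x) -ᵥ x ∈ vectorSpan ℝ {y | l y = c} :=
      vsub_mem_vectorSpan ℝ (by simp [hz', hx]) hx
    simpa using this

/-- A point of `H_ε ∩ H_ε'` at which no forms vanish but those vanishing on `H_ε ∩ H_ε'` lies in
an `(n - 2)`-chamber. -/
theorem isChamber_two_signCell {ε ε' : Fin n → ℤˣ} {k m : Fin n} (hk : ε k = ε' k)
    (hm : ε' m = -ε m) {x : Fin n → ℝ} (hx : form (Sum.inl ε) x = 0)
    (hx' : form (Sum.inl ε') x = 0)
    (hL : ∀ y, form (Sum.inl ε) y = 0 → form (Sum.inl ε') y = 0 →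
      ∀ j, form j x = 0 → form j y = 0) :
    IsChamber 2 (signCell (signAt x)) := by
  refine isChamber_signCell ⟨x, mem_signCell_signAt x⟩ ?_
  set l : (Fin n → ℝ) →ₗ[ℝ] ℝ × ℝ := (linForm (Sum.inl ε)).prod (linForm (Sum.inl ε'))
  have h1 : {y : Fin n → ℝ | ∀ j, signAt x j = 0 → form j y = 0} = {y | l y = (1, 1)} := by
    ext y
    simp only [mem_ofPred_eq, signAt_eq_zero]
    change _ ↔ (linForm (Sum.inl ε) y, linForm (Sum.inl ε') y) = (1, 1)
    rw [Prod.mk.injEq, ← sub_eq_zero, ← form_inl_eq, ← sub_eq_zero (b := (1 : ℝ)), ← form_inl_eq]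
    exact ⟨fun h => ⟨h _ hx, h _ hx'⟩, fun h => hL y h.1 h.2⟩
  have hlx : l x = (1, 1) := by
    rw [form_inl_eq, sub_eq_zero] at hx hx'
    exact Prod.ext hx hx'
  rw [h1, vectorSpan_preimage_singleton l _ hlx]
  have hrange : LinearMap.range l = ⊤ := by
    rw [LinearMap.range_eq_top]
    rintro ⟨p, q⟩
    refine ⟨direction ε k m p q, Prod.ext ?_ ?_⟩
    exacts [linForm_direction_left _ _ _ _ _, linForm_direction_right hk hm _ _]
  have h2 := LinearMap.finrank_range_add_finrank_ker l
  rw [hrange, finrank_top, Module.finrank_prod, Module.finrank_self, Module.finrank_fin_fun] at h2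
  omega

theorem signType_sign_coe (δ : SignType) : SignType.sign (((δ : ℤ) : ℝ)) = δ := by
  cases δ <;> simp

theorem ne_of_apply_eq_neg {ε ε' : Fin n → ℤˣ} {m : Fin n} (hm : ε' m = -ε m) : ε ≠ ε' := by
  rintro rfl
  rcases Int.units_eq_one_or (ε m) with h | h <;> rw [h] at hm <;> exact absurd hm (by decide)

/-- Around an `(n - 2)`-chamber in exactly two hyperplanes `H_ε` and `H_ε'`: crossing `H_ε'` does
not change the loop across `H_ε`, and the two loops commute. -/
theorem wallLoop_of_two_hyperplanes [NeZero n] (v : VertexChoice n) {ε ε' : Fin n → ℤˣ}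
    {k m : Fin n} (hk : ε k = ε' k) (hm : ε' m = -ε m) {x : Fin n → ℝ} (hpos : ∀ i, 0 < x i)
    (hz : ∀ j, form j x = 0 ↔ j = Sum.inl ε ∨ j = Sum.inl ε')
    {T : SignType → SignType → (Fin n → ℤˣ) ⊕ Fin n → SignType}
    (hT : T = fun a b => Function.update (Function.update (signAt x) (Sum.inl ε) a)
      (Sum.inl ε') b) :
    IsOrthantWall (T 0 1) (Sum.inl ε) ∧ IsOrthantWall (T 1 0) (Sum.inl ε') ∧
    wallLoop v (T 0 (-1)) (Sum.inl ε) (-1) = wallLoop v (T 0 1) (Sum.inl ε) (-1) ∧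
    Commute (wallLoop v (T 0 1) (Sum.inl ε) (-1)) (wallLoop v (T 1 0) (Sum.inl ε') (-1)) := by
  have hεε' : ε ≠ ε' := ne_of_apply_eq_neg hm
  have hτ : IsChamber 2 (signCell (signAt x)) := by
    refine isChamber_two_signCell hk hm ((hz _).2 (Or.inl rfl)) ((hz _).2 (Or.inr rfl)) ?_
    intro y h1 h2 j hj
    rcases (hz j).1 hj with rfl | rfl
    exacts [h1, h2]
  have hT1 : ∀ a b, T a b (Sum.inl ε) = a := fun a b => by simp [hT, hεε']
  have hT2 : ∀ a b, T a b (Sum.inl ε') = b := fun a b => by simp [hT]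
  have hT3 : ∀ a b j, form j x ≠ 0 → T a b j = signAt x j := fun a b j hj => by
    rw [hT]
    have := mt (hz j).2 hj
    push Not at this
    simp [this.1, this.2]
  have hu1 : ∀ a b c, Function.update (T a b) (Sum.inl ε) c = T c b := fun a b c => by
    rw [hT]
    dsimp only
    rw [Function.update_comm (by simpa using hεε'.symm), Function.update_idem]
  have hu2 : ∀ a b c, Function.update (T a b) (Sum.inl ε') c = T a c := fun a b c => by
    rw [hT]
    dsimp only
    rw [Function.update_idem]
  have hne : ∀ a b, (signCell (T a b)).Nonempty := fun a b => by
    refine signCell_nonempty_of_direction x (direction ε k m ((a : ℤ) : ℝ) ((b : ℤ) : ℝ))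
      (hT3 a b) fun j hj => ?_
    rcases (hz j).1 hj with rfl | rfl
    · rw [hT1, linForm_direction_left, signType_sign_coe]
    · rw [hT2, linForm_direction_right hk hm, signType_sign_coe]
  have hnz : ∀ a b j, form j x ≠ 0 → T a b j ≠ 0 := fun a b j hj => by
    rw [hT3 a b j hj]; exact mt signAt_eq_zero.1 hj
  have hw1 : ∀ b, b ≠ 0 → ∀ j, T 0 b j = 0 ↔ j = Sum.inl ε := fun b hb j => by
    constructor
    · intro h
      rcases (hz j).1 (by by_contra hj; exact hnz _ _ j hj h) with rfl | rfl
      · rfl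
      · exact (hb (by rwa [hT2] at h)).elim
    · rintro rfl; exact hT1 _ _
  have hw2 : ∀ a, a ≠ 0 → ∀ j, T a 0 j = 0 ↔ j = Sum.inl ε' := fun a ha j => by
    constructor
    · intro h
      rcases (hz j).1 (by by_contra hj; exact hnz _ _ j hj h) with rfl | rfl
      · exact (ha (by rwa [hT1] at h)).elim
      · rfl
    · rintro rfl; exact hT2 _ _
  have hch : ∀ a b, a ≠ 0 → b ≠ 0 → ∀ j, T a b j ≠ 0 := fun a b ha hb j h => by
    rcases (hz j).1 (by by_contra hj; exact hnz _ _ j hj h) with rfl | rfl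
    · exact ha (by rwa [hT1] at h)
    · exact hb (by rwa [hT2] at h)
  have href : ∀ a b j, signAt x j = 0 ∨ signAt x j = T a b j := fun a b j => by
    by_cases hj : form j x = 0
    · exact Or.inl (signAt_eq_zero.2 hj)
    · exact Or.inr (hT3 a b j hj).symm
  have hTpos : ∀ a b i, T a b (Sum.inr i) = 1 := fun a b i => by
    rw [hT3 a b (Sum.inr i) (hpos i).ne']; exact sign_pos (hpos i)
  have p : (1 : SignType) ≠ 0 := by decide
  have q : (-1 : SignType) ≠ 0 := by decide
  have out1 : ∀ b, b ≠ 0 → wallLoop v (T 0 b) (Sum.inl ε) 1 = 1 := fun b hb =>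
    wallLoop_outward_eq_one v (hne _ _) (hw1 b hb) (hTpos _ _)
  have out2 : ∀ a, a ≠ 0 → wallLoop v (T a 0) (Sum.inl ε') 1 = 1 := fun a ha =>
    wallLoop_outward_eq_one v (hne _ _) (hw2 a ha) (hTpos _ _)
  -- crossing the two walls in terms of the potential of the `2`-cell starting at `T c d`
  have pot : ∀ c d, c ≠ 0 → d ≠ 0 → ∃ e : SignType → SignType → PiOne (XBarS v) (basePoint v),
      (∀ b, b ≠ 0 → wallLoop v (T 0 b) (Sum.inl ε) (-c) = (e c b)⁻¹ * e (-c) b) ∧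
      (∀ a, a ≠ 0 → wallLoop v (T a 0) (Sum.inl ε') (-d) = (e a d)⁻¹ * e a (-d)) := by
    intro c d hc hd
    obtain ⟨e, he⟩ := exists_wallLoop_potential v hτ (hne c d) (hch c d hc hd) (href c d)
    refine ⟨fun a b => e (T a b), fun b hb => ?_, fun a ha => ?_⟩
    · rw [he _ _ _ (hne 0 b) (hw1 b hb) (href 0 b) (by rw [hT1, neg_neg]), hu1, hu1, neg_neg]
    · rw [he _ _ _ (hne a 0) (hw2 a ha) (href a 0) (by rw [hT2, neg_neg]), hu2, hu2, neg_neg]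
  have key : wallLoop v (T 0 (-1)) (Sum.inl ε) (-1) = wallLoop v (T 0 1) (Sum.inl ε) (-1) := by
    obtain ⟨e, h1, h2⟩ := pot 1 (-1) p q
    have b1 := h2 (-1) q
    have b2 := h2 1 p
    rw [neg_neg, out2 _ q, eq_comm, inv_mul_eq_one] at b1
    rw [neg_neg, out2 _ p, eq_comm, inv_mul_eq_one] at b2
    rw [h1 (-1) q, h1 1 p, b1, b2]
  have key' : wallLoop v (T (-1) 0) (Sum.inl ε') (-1) = wallLoop v (T 1 0) (Sum.inl ε') (-1) := by
    obtain ⟨e, h1, h2⟩ := pot (-1) 1 q p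
    have a1 := h1 (-1) q
    have a2 := h1 1 p
    rw [neg_neg, out1 _ q, eq_comm, inv_mul_eq_one] at a1
    rw [neg_neg, out1 _ p, eq_comm, inv_mul_eq_one] at a2
    rw [h2 (-1) q, h2 1 p, a1, a2]
  refine ⟨⟨⟨hne _ _, hw1 _ p⟩, fun i _ => hTpos _ _ i⟩,
    ⟨⟨hne _ _, hw2 _ p⟩, fun i _ => hTpos _ _ i⟩, key, ?_⟩
  obtain ⟨e, h1, h2⟩ := pot 1 1 p p
  change _ * _ = _ * _
  conv_lhs => rw [← key', h1 1 p, h2 (-1) q]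
  conv_rhs => rw [← key, h2 1 p, h1 (-1) q]
  group

/-- Around an `(n - 2)`-chamber in the three hyperplanes `H_ε`, `H_ε'` and `L_m`, where `ε'`
arises from `ε` by changing the sign at `m`: crossing `H_ε` and `H_ε'` does not change the loop
across `L_m`, which conjugates the loop across `H_ε` into the loop across `H_ε'`. -/
theorem wallLoop_of_three_hyperplanes [NeZero n] (v : VertexChoice n) {ε ε' : Fin n → ℤˣ}
    {k m : Fin n} (hk : ε k = ε' k) (hm : ε m = 1) (hε' : ε' = ε * reflection m)
    {x : Fin n → ℝ} (hpos : ∀ i, i ≠ m → 0 < x i)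
    (hz : ∀ j, form j x = 0 ↔ j = Sum.inl ε ∨ j = Sum.inl ε' ∨ j = Sum.inr m)
    {T : SignType → SignType → SignType → (Fin n → ℤˣ) ⊕ Fin n → SignType}
    (hT : T = fun a b c => Function.update (Function.update (Function.update (signAt x)
      (Sum.inl ε) a) (Sum.inl ε') b) (Sum.inr m) c) :
    IsOrthantWall (T 0 (-1) 1) (Sum.inl ε) ∧ IsOrthantWall (T 1 0 1) (Sum.inl ε') ∧
    IsOrthantWall (T 1 1 0) (Sum.inr m) ∧
    wallLoop v (T 1 1 0) (Sum.inr m) (-1) = wallLoop v (T (-1) (-1) 0) (Sum.inr m) (-1) ∧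
    wallLoop v (T 1 1 0) (Sum.inr m) (-1) * wallLoop v (T 1 0 1) (Sum.inl ε') (-1) =
      wallLoop v (T 0 (-1) 1) (Sum.inl ε) (-1) * wallLoop v (T 1 1 0) (Sum.inr m) (-1) := by
  have hm' : ε' m = -ε m := by rw [hε']; simp [reflection]
  have hεε' : ε ≠ ε' := ne_of_apply_eq_neg hm'
  have hrx : signAct (reflection m) x = x := by
    funext i
    by_cases hi : i = m
    · subst hi
      have : x i = 0 := (hz (Sum.inr i)).2 (by simp)
      simp [signAct, this]
    · simp [signAct, reflection, hi]
  have hτ : IsChamber 2 (signCell (signAt x)) := by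
    refine isChamber_two_signCell hk hm' ((hz _).2 (by simp)) ((hz _).2 (by simp)) ?_
    intro y h1 h2 j hj
    rcases (hz j).1 hj with rfl | rfl | rfl
    · exact h1
    · exact h2
    · -- the difference of the two forms is `2 x_m`
      have h3 : signAct (reflection m) y = y - Pi.single m (2 * y m) := by
        funext i
        by_cases hi : i = m
        · subst hi; simp [signAct, reflection]; ring
        · simp [signAct, reflection, hi]
      rw [hε', ← form_inl_signAct, h3, form_inl_eq, map_sub, linForm_inl_single, hm] at h2
      rw [form_inl_eq] at h1
      change y m = 0
      simp only [Units.val_one, Int.cast_one, one_mul] at h2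
      linarith
  have hT1 : ∀ a b c, T a b c (Sum.inl ε) = a := fun a b c => by simp [hT, hεε']
  have hT2 : ∀ a b c, T a b c (Sum.inl ε') = b := fun a b c => by simp [hT]
  have hT3 : ∀ a b c, T a b c (Sum.inr m) = c := fun a b c => by simp [hT]
  have hT4 : ∀ a b c j, form j x ≠ 0 → T a b c j = signAt x j := fun a b c j hj => by
    rw [hT]
    have := mt (hz j).2 hj
    push Not at this
    simp [this.1, this.2.1, this.2.2]
  have hext : ∀ (s : (Fin n → ℤˣ) ⊕ Fin n → SignType) a b c, s (Sum.inl ε) = a →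
      s (Sum.inl ε') = b → s (Sum.inr m) = c → (∀ j, form j x ≠ 0 → s j = signAt x j) →
      s = T a b c := by
    intro s a b c h1 h2 h3 h4
    funext j
    by_cases hj : form j x = 0
    · rcases (hz j).1 hj with rfl | rfl | rfl
      · rw [hT1, h1]
      · rw [hT2, h2]
      · rw [hT3, h3]
    · rw [hT4 _ _ _ _ hj, h4 _ hj]
  have hoff : ∀ (a b c d : SignType) (j₀ : (Fin n → ℤˣ) ⊕ Fin n), form j₀ x = 0 →
      ∀ j, form j x ≠ 0 → Function.update (T a b c) j₀ d j = signAt x j := by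
    intro a b c d j₀ h₀ j hj
    rw [Function.update_of_ne (by rintro rfl; exact hj h₀), hT4 _ _ _ _ hj]
  have hu1 : ∀ a b c d, Function.update (T a b c) (Sum.inl ε) d = T d b c := fun a b c d =>
    hext _ _ _ _ (by simp) (by simp [hεε'.symm, hT2]) (by simp [hT3])
      (hoff a b c d _ ((hz _).2 (by simp)))
  have hu2 : ∀ a b c d, Function.update (T a b c) (Sum.inl ε') d = T a d c := fun a b c d =>
    hext _ _ _ _ (by simp [hεε', hT1]) (by simp) (by simp [hT3])
      (hoff a b c d _ ((hz _).2 (by simp)))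
  have hu3 : ∀ a b c d, Function.update (T a b c) (Sum.inr m) d = T a b d := fun a b c d =>
    hext _ _ _ _ (by simp [hT1]) (by simp [hT2]) (by simp)
      (hoff a b c d _ ((hz _).2 (by simp)))
  -- the reflection in `L_m` exchanges the two hyperplanes
  have hact : ∀ a b c, signVecAct (reflection m) (T a b c) = T b a (-c) := fun a b c => by
    refine hext _ _ _ _ ?_ ?_ ?_ ?_
    · simp only [signVecAct, ← hε', hT2]
    · simp only [signVecAct, hε', mul_assoc, units_pi_mul_self, mul_one, hT1]
    · simp [signVecAct, reflection, hT3]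
    · rintro (μ | i) hj
      · have h1 : form (Sum.inl (μ * reflection m)) x = form (Sum.inl μ) x := by
          rw [← form_inl_signAct, hrx]
        change T a b c (Sum.inl (μ * reflection m)) = _
        rw [hT4 _ _ _ _ (by rwa [h1]), signAt, signAt, h1]
      · have hi : i ≠ m := by
          rintro rfl
          exact hj ((hz _).2 (by simp))
        simp [signVecAct, reflection, hi, hT4 _ _ _ _ hj]
  have hne : ∀ (a b : ℝ), (signCell (T (SignType.sign a) (SignType.sign b)
      (SignType.sign ((a - b) / 2)))).Nonempty := fun a b => by
    refine signCell_nonempty_of_direction x (direction ε k m a b) (hT4 _ _ _) fun j hj => ?_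
    rcases (hz j).1 hj with rfl | rfl | rfl
    · rw [hT1, linForm_direction_left]
    · rw [hT2, linForm_direction_right hk hm']
    · rw [hT3, linForm_inr_apply, direction_apply hk hm', hm]; simp
  have hnz : ∀ a b c j, T a b c j = 0 → j = Sum.inl ε ∧ a = 0 ∨ j = Sum.inl ε' ∧ b = 0 ∨
      j = Sum.inr m ∧ c = 0 := fun a b c j h => by
    have hj : form j x = 0 := by
      by_contra hj
      rw [hT4 _ _ _ j hj] at h
      exact hj (signAt_eq_zero.1 h)
    rcases (hz j).1 hj with rfl | rfl | rfl
    · rw [hT1] at h; simp [h]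
    · rw [hT2] at h; simp [h]
    · rw [hT3] at h; simp [h]
  have href : ∀ a b c j, signAt x j = 0 ∨ signAt x j = T a b c j := fun a b c j => by
    by_cases hj : form j x = 0
    · exact Or.inl (signAt_eq_zero.2 hj)
    · exact Or.inr (hT4 a b c j hj).symm
  have hTpos : ∀ a b i, T a b 1 (Sum.inr i) = 1 := fun a b i => by
    by_cases hi : i = m
    · rw [hi, hT3]
    · rw [hT4 a b 1 (Sum.inr i) (hpos i hi).ne']; exact sign_pos (hpos i hi)
  have hw1 : ∀ b c, b ≠ 0 → c ≠ 0 → ∀ j, T 0 b c j = 0 ↔ j = Sum.inl ε := fun b c hb hc j => by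
    refine ⟨fun h => ?_, fun h => by rw [h, hT1]⟩
    rcases hnz _ _ _ _ h with h | h | h
    exacts [h.1, (hb h.2).elim, (hc h.2).elim]
  have hw2 : ∀ a c, a ≠ 0 → c ≠ 0 → ∀ j, T a 0 c j = 0 ↔ j = Sum.inl ε' := fun a c ha hc j => by
    refine ⟨fun h => ?_, fun h => by rw [h, hT2]⟩
    rcases hnz _ _ _ _ h with h | h | h
    exacts [(ha h.2).elim, h.1, (hc h.2).elim]
  have hw3 : ∀ a b, a ≠ 0 → b ≠ 0 → ∀ j, T a b 0 j = 0 ↔ j = Sum.inr m := fun a b ha hb j => by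
    refine ⟨fun h => ?_, fun h => by rw [h, hT3]⟩
    rcases hnz _ _ _ _ h with h | h | h
    exacts [(ha h.2).elim, (hb h.2).elim, h.1]
  have hch : ∀ a b c, a ≠ 0 → b ≠ 0 → c ≠ 0 → ∀ j, T a b c j ≠ 0 := fun a b c ha hb hc j h => by
    rcases hnz _ _ _ _ h with h | h | h
    exacts [ha h.2, hb h.2, hc h.2]
  have p : (1 : SignType) ≠ 0 := by decide
  have q : (-1 : SignType) ≠ 0 := by decide
  -- the nonempty cells around the face, in cyclic order
  have n1 : (signCell (T (-1) (-1) 1)).Nonempty := by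
    have := hne (-1) (-2); norm_num at this; exact this
  have n2 : (signCell (T 0 (-1) 1)).Nonempty := by
    have := hne 0 (-1); norm_num at this; exact this
  have n3 : (signCell (T 1 (-1) 1)).Nonempty := by
    have := hne 1 (-1); norm_num at this; exact this
  have n4 : (signCell (T 1 0 1)).Nonempty := by
    have := hne 1 0; norm_num at this; exact this
  have n5 : (signCell (T 1 1 0)).Nonempty := by
    have := hne 1 1; norm_num at this; exact this
  have n6 : (signCell (T 0 1 (-1))).Nonempty := by
    have := hne 0 1; norm_num at this; exact this
  have n7 : (signCell (T (-1) 0 (-1))).Nonempty := by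
    have := hne (-1) 0; norm_num at this; exact this
  have n8 : (signCell (T (-1) (-1) 0)).Nonempty := by
    have := hne (-1) (-1); norm_num at this; exact this
  -- outward crossings and their mirror images are trivial
  have o1 : wallLoop v (T 0 (-1) 1) (Sum.inl ε) 1 = 1 :=
    wallLoop_outward_eq_one v n2 (hw1 _ _ q p) (hTpos _ _)
  have o2 : wallLoop v (T 1 0 1) (Sum.inl ε') 1 = 1 :=
    wallLoop_outward_eq_one v n4 (hw2 _ _ p p) (hTpos _ _)
  have hε : ε = ε' * reflection m := by rw [hε', mul_assoc, units_pi_mul_self, mul_one]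
  have m1 : ∀ δ, δ ≠ 0 → wallLoop v (T (-1) 0 (-1)) (Sum.inl ε') δ
      = wallLoop v (T 0 (-1) 1) (Sum.inl ε) δ := fun δ hδ => by
    rw [← wallLoop_signVecAct v (reflection m) n2 (hw1 _ _ q p) hδ, hact, ← hε']
  have m2 : ∀ δ, δ ≠ 0 → wallLoop v (T 0 1 (-1)) (Sum.inl ε) δ
      = wallLoop v (T 1 0 1) (Sum.inl ε') δ := fun δ hδ => by
    rw [← wallLoop_signVecAct v (reflection m) n4 (hw2 _ _ p p) hδ, hact, ← hε]
  refine ⟨⟨⟨n2, hw1 _ _ q p⟩, fun i _ => hTpos _ _ i⟩, ⟨⟨n4, hw2 _ _ p p⟩, fun i _ => hTpos _ _ i⟩,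
    ⟨⟨n5, hw3 _ _ p p⟩, fun i hi => ?_⟩, ?_⟩
  · have hi' : i ≠ m := fun h => hi (by rw [h])
    rw [hT4 _ _ _ (Sum.inr i) (hpos i hi').ne']; exact sign_pos (hpos i hi')
  have hG : wallLoop v (T 1 1 0) (Sum.inr m) (-1)
      = wallLoop v (T (-1) (-1) 0) (Sum.inr m) (-1) := by
    -- the galleries from the chamber below both hyperplanes, with `x_m > 0`
    obtain ⟨e, he⟩ := exists_wallLoop_potential v hτ n1 (hch _ _ _ q q p) (href _ _ _)
    have r1 := he _ _ 1 n2 (hw1 _ _ q p) (href _ _ _) (by rw [hT1])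
    have r2 := he _ _ 1 n4 (hw2 _ _ p p) (href _ _ _) (by rw [hT2])
    have r3 := he _ _ (-1) n5 (hw3 _ _ p p) (href _ _ _) (by rw [hT3, neg_neg])
    have r4 := he _ _ 1 n6 (hw1 _ _ p q) (href _ _ _) (by rw [hT1])
    have r5 := he _ _ 1 n7 (hw2 _ _ q q) (href _ _ _) (by rw [hT2])
    have r6 := he _ _ (-1) n8 (hw3 _ _ q q) (href _ _ _) (by rw [hT3, neg_neg])
    rw [o1, hu1, hu1, eq_comm, inv_mul_eq_one] at r1
    rw [o2, hu2, hu2, eq_comm, inv_mul_eq_one] at r2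
    rw [m2 _ p, o2, hu1, hu1, eq_comm, inv_mul_eq_one] at r4
    rw [m1 _ p, o1, hu2, hu2, eq_comm, inv_mul_eq_one] at r5
    rw [r3, r6, hu3, hu3, hu3, hu3, neg_neg, r1, r2, ← r4, ← r5]
  refine ⟨hG, ?_⟩
  -- the galleries from the chamber between the hyperplanes, with `x_m > 0`
  obtain ⟨e, he⟩ := exists_wallLoop_potential v hτ n3 (hch _ _ _ p q p) (href _ _ _)
  have r1 := he _ _ (-1) n2 (hw1 _ _ q p) (href _ _ _) (by rw [hT1, neg_neg])
  have r2 := he _ _ 1 n4 (hw2 _ _ p p) (href _ _ _) (by rw [hT2])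
  have r3 := he _ _ (-1) n5 (hw3 _ _ p p) (href _ _ _) (by rw [hT3, neg_neg])
  have r4 := he _ _ (-1) n6 (hw1 _ _ p q) (href _ _ _) (by rw [hT1, neg_neg])
  have r5 := he _ _ 1 n7 (hw2 _ _ q q) (href _ _ _) (by rw [hT2])
  have r6 := he _ _ (-1) n8 (hw3 _ _ q q) (href _ _ _) (by rw [hT3, neg_neg])
  rw [o2, hu2, hu2, eq_comm, inv_mul_eq_one] at r2
  rw [m1 _ p, o1, hu2, hu2, eq_comm, inv_mul_eq_one] at r5
  rw [m2 _ q, hu1, hu1, neg_neg] at r4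
  rw [hu1, hu1, neg_neg] at r1
  rw [hu3, hu3, neg_neg] at r3 r6
  rw [r4]
  conv_rhs => rw [hG, r1, r6, r5]
  rw [r3, ← r2]
  group

end CodimTwo

/-! ### General position -/

section GeneralPosition

variable {n : ℕ}

/-- Near every point of a set `M` closed under affine combinations there is a point of `M` at
which given affine functions, none of them identically zero on `M`, do not vanish. -/
theorem exists_forall_ne_zero {ι : Type*} (I : Finset ι) (F : ι → (Fin n → ℝ) → ℝ)
    (hF : ∀ i x y (a b : ℝ), a + b = 1 → F i (a • x + b • y) = a * F i x + b * F i y)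
    {M : Set (Fin n → ℝ)} (hM : ∀ x ∈ M, ∀ y ∈ M, ∀ a b : ℝ, a + b = 1 → a • x + b • y ∈ M)
    (hne : ∀ i ∈ I, ∃ z ∈ M, F i z ≠ 0) {y : Fin n → ℝ} (hy : y ∈ M) {N : Set (Fin n → ℝ)}
    (hN : N ∈ nhds y) : ∃ y' ∈ M ∩ N, ∀ i ∈ I, F i y' ≠ 0 := by
  classical
  obtain ⟨N', hN'N, hN', hyN'⟩ := mem_nhds_iff.1 hN
  suffices ∃ y' ∈ M ∩ N', ∀ i ∈ I, F i y' ≠ 0 by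
    obtain ⟨y', hy', h⟩ := this
    exact ⟨y', ⟨hy'.1, hN'N hy'.2⟩, h⟩
  clear hN hN'N
  induction I using Finset.induction_on with
  | empty => exact ⟨y, ⟨hy, hyN'⟩, by simp⟩
  | insert i I _ ih =>
    obtain ⟨y', ⟨hyM, hyN⟩, h⟩ := ih fun i' hi' => hne i' (Finset.mem_insert_of_mem hi')
    obtain ⟨z, hz, hzF⟩ := hne i (Finset.mem_insert_self _ _)
    have hc : Continuous fun t : ℝ => (1 - t) • y' + t • z := by fun_prop
    have h1 : ∀ᶠ t in nhdsWithin (0 : ℝ) (Ioi 0), (1 - t) • y' + t • z ∈ N' := by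
      refine (hc.continuousAt.eventually ?_).filter_mono nhdsWithin_le_nhds
      simpa using hN'.mem_nhds hyN
    have h2 : ∀ i', F i' y' ≠ 0 →
        ∀ᶠ t in nhdsWithin (0 : ℝ) (Ioi 0), (1 - t) * F i' y' + t * F i' z ≠ 0 := by
      intro i' hi'
      have hc' : Continuous fun t : ℝ => (1 - t) * F i' y' + t * F i' z := by fun_prop
      refine (hc'.continuousAt.eventually_ne ?_).filter_mono nhdsWithin_le_nhds
      simpa using hi'
    have h3 : ∀ᶠ t in nhdsWithin (0 : ℝ) (Ioi 0), (1 - t) * F i y' + t * F i z ≠ 0 := by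
      by_cases hi : F i y' = 0
      · filter_upwards [self_mem_nhdsWithin] with t ht
        rw [hi, mul_zero, zero_add]
        exact mul_ne_zero (ne_of_gt ht) hzF
      · exact h2 i hi
    have h4 : ∀ᶠ t in nhdsWithin (0 : ℝ) (Ioi 0),
        ∀ i' ∈ I, (1 - t) * F i' y' + t * F i' z ≠ 0 :=
      (Filter.eventually_all_finset I).2 fun i' hi' => h2 i' (h i' hi')
    obtain ⟨t, ht1, ht3, ht4⟩ := (h1.and (h3.and h4)).exists
    refine ⟨_, ⟨hM _ hyM _ hz _ _ (sub_add_cancel 1 t), ht1⟩, fun i' hi' => ?_⟩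
    rw [hF _ _ _ _ _ (sub_add_cancel 1 t)]
    rcases Finset.mem_insert.1 hi' with rfl | hi'
    exacts [ht3, ht4 i' hi']

theorem form_comb_mem {j : (Fin n → ℤˣ) ⊕ Fin n} {x y : Fin n → ℝ} (hx : form j x = 0)
    (hy : form j y = 0) {a b : ℝ} (hab : a + b = 1) : form j (a • x + b • y) = 0 := by
  rw [form_comb _ _ _ hab, hx, hy]; ring

/-- A function of the walls in a hyperplane (and in the closed positive orthant) is constant if it
takes equal values at the walls around each point of the hyperplane through which at most one trace
of the other hyperplanes passes. The relation `R` holds if two hyperplanes may have the same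
trace. Two points in general position are joined by a segment that meets the traces one at a time,
and along this segment the function is locally constant. -/
theorem eq_of_forall_codim_two {α : Type*} {j₀ : (Fin n → ℤˣ) ⊕ Fin n}
    (C : ((Fin n → ℤˣ) ⊕ Fin n → SignType) → α) (R : (Fin n → ℤˣ) → (Fin n → ℤˣ) → Prop)
    (hR : ∀ y : Fin n → ℝ, (∀ j, form j y = 0 ↔ j = j₀) → ∀ μ ν, Sum.inl μ ≠ j₀ →
      Sum.inl ν ≠ j₀ → ¬ R μ ν → ∃ z, form j₀ z = 0 ∧
        form (Sum.inl μ) y * form (Sum.inl ν) z - form (Sum.inl ν) y * form (Sum.inl μ) z ≠ 0)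
    (hC : ∀ x : Fin n → ℝ, form j₀ x = 0 → (∀ i, Sum.inr i ≠ j₀ → 0 < x i) →
      (∀ μ ν, Sum.inl μ ≠ j₀ → Sum.inl ν ≠ j₀ → form (Sum.inl μ) x = 0 →
        form (Sum.inl ν) x = 0 → R μ ν) →
      ∀ s s', IsWall s j₀ → IsWall s' j₀ → (∀ j, form j x ≠ 0 → s j = signAt x j) →
        (∀ j, form j x ≠ 0 → s' j = signAt x j) → C s = C s')
    {s s' : (Fin n → ℤˣ) ⊕ Fin n → SignType} (hs : IsOrthantWall s j₀)
    (hs' : IsOrthantWall s' j₀) : C s = C s' := by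
  classical
  obtain ⟨y₀, hy₀⟩ := hs.nonempty
  obtain ⟨y₁, hy₁⟩ := hs'.nonempty
  obtain rfl := signAt_eq_of_mem hy₀
  obtain rfl := signAt_eq_of_mem hy₁
  have hz₀ : ∀ j, form j y₀ = 0 ↔ j = j₀ := fun j => signAt_eq_zero.symm.trans (hs.eq_zero_iff j)
  have hz₁ : ∀ j, form j y₁ = 0 ↔ j = j₀ := fun j => signAt_eq_zero.symm.trans (hs'.eq_zero_iff j)
  -- move `y₁` inside its chamber so that the segment from `y₀` is in general position
  obtain ⟨y₂, ⟨hy₂M, hy₂N⟩, hy₂⟩ := exists_forall_ne_zero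
    (Finset.univ.filter fun p : (Fin n → ℤˣ) × (Fin n → ℤˣ) =>
      Sum.inl p.1 ≠ j₀ ∧ Sum.inl p.2 ≠ j₀ ∧ ¬ R p.1 p.2)
    (fun p z => form (Sum.inl p.1) y₀ * form (Sum.inl p.2) z -
      form (Sum.inl p.2) y₀ * form (Sum.inl p.1) z)
    (fun p x y a b hab => by
      rw [form_comb _ _ _ hab, form_comb _ _ _ hab]; ring)
    (M := {z | form j₀ z = 0}) (fun x hx y hy a b hab => form_comb_mem hx hy hab)
    (fun p hp => by
      obtain ⟨h1, h2, h3⟩ := (Finset.mem_filter.1 hp).2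
      exact hR y₀ hz₀ _ _ h1 h2 h3)
    ((hz₁ j₀).2 rfl) (eventually_signAt_eq y₁)
  have hy₂M' : form j₀ y₂ = 0 := hy₂M
  have hsign : signAt y₂ = signAt y₁ := by
    funext j
    by_cases hj : j = j₀
    · rw [hj, signAt_eq_zero.2 hy₂M', signAt_eq_zero.2 ((hz₁ j₀).2 rfl)]
    · exact hy₂N j fun h => hj ((hz₁ j).1 h)
  have hz₂ : ∀ j, form j y₂ = 0 ↔ j = j₀ := fun j => by
    rw [← signAt_eq_zero, hsign, signAt_eq_zero, hz₁]
  let p : unitInterval → (Fin n → ℝ) := fun t => (1 - (t : ℝ)) • y₀ + (t : ℝ) • y₂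
  have hp : ∀ j t, form j (p t) = (1 - (t : ℝ)) * form j y₀ + t * form j y₂ := fun j t =>
    form_comb _ _ _ (sub_add_cancel _ _)
  have hpc : Continuous p := by fun_prop
  have hp₀ : ∀ t, form j₀ (p t) = 0 := fun t => form_comb_mem ((hz₀ _).2 rfl) hy₂M'
    (sub_add_cancel _ _)
  have hppos : ∀ t i, Sum.inr i ≠ j₀ → 0 < p t i := by
    intro t i hi
    have h0 : 0 < y₀ i := sign_eq_one_iff.1 (hs.eq_one i hi)
    have h2 : 0 < y₂ i := by
      have := hs'.eq_one i hi
      rw [← hsign] at this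
      exact sign_eq_one_iff.1 this
    have h3 := hp (Sum.inr i) t
    change p t i = (1 - (t : ℝ)) * y₀ i + t * y₂ i at h3
    rw [h3]
    have ht0 := t.2.1
    have ht1 := t.2.2
    rcases ht0.eq_or_lt with ht | ht
    · rw [← ht]; linarith
    · nlinarith [mul_pos ht h2, mul_nonneg (sub_nonneg.2 ht1) h0.le]
  have hpR : ∀ t μ ν, Sum.inl μ ≠ j₀ → Sum.inl ν ≠ j₀ → form (Sum.inl μ) (p t) = 0 →
      form (Sum.inl ν) (p t) = 0 → R μ ν := by
    intro t μ ν hμ hν h1 h2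
    by_contra hRμν
    rw [hp] at h1 h2
    refine hy₂ (μ, ν) (Finset.mem_filter.2 ⟨Finset.mem_univ _, hμ, hν, hRμν⟩) ?_
    have ht : (t : ℝ) ≠ 0 := fun ht => hμ ((hz₀ _).1 (by rw [ht] at h1; linarith))
    refine (mul_eq_zero.1 (?_ : (t : ℝ) * _ = 0)).resolve_left ht
    dsimp only
    linear_combination form (Sum.inl μ) y₀ * h2 - form (Sum.inl ν) y₀ * h1
  -- the wall met by the segment just before the time `t`
  let w : unitInterval → (Fin n → ℤˣ) ⊕ Fin n → SignType := fun t j =>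
    if form j (p t) = 0 then signAt y₀ j else signAt (p t) j
  have hw : ∀ t, IsWall (w t) j₀ := by
    intro t
    refine ⟨signCell_nonempty_of_direction (p t) (y₀ - p t) (fun j hj => if_neg hj)
      fun j hj => ?_, fun j => ?_⟩
    · have h1 := form_add_smul j (p t) (y₀ - p t) 1
      rw [one_smul, add_sub_cancel, hj, zero_add, one_mul] at h1
      rw [← h1]
      exact if_pos hj
    · by_cases hj : form j (p t) = 0
      · simp only [w, if_pos hj]
        exact signAt_eq_zero.trans (hz₀ j)
      · simp only [w, if_neg hj]
        refine ⟨fun h => (hj (signAt_eq_zero.1 h)).elim, ?_⟩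
        rintro rfl
        exact (hj (hp₀ t)).elim
  have hlc : IsLocallyConstant fun t => C (w t) := by
    rw [IsLocallyConstant.iff_eventually_eq]
    intro t
    filter_upwards [hpc.continuousAt.eventually (eventually_signAt_eq (p t))] with t' ht'
    refine hC (p t) (hp₀ t) (hppos t) (hpR t) _ _ (hw t') (hw t) (fun j hj => ?_)
      fun j hj => if_neg hj
    have hj' : form j (p t') ≠ 0 := fun h =>
      hj (signAt_eq_zero.1 ((ht' j hj).symm.trans (signAt_eq_zero.2 h)))
    simp only [w, if_neg hj']
    exact ht' j hj
  have hw₀ : w 0 = signAt y₀ := by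
    funext j
    have : p 0 = y₀ := by simp [p]
    simp only [w, this, ite_self]
  have hw₁ : w 1 = signAt y₁ := by
    funext j
    have : p 1 = y₂ := by simp [p]
    simp only [w, this]
    by_cases hj : form j y₂ = 0
    · rw [if_pos hj, ← hsign, signAt_eq_zero.2 hj, signAt_eq_zero.2]
      rw [hz₀, ← hz₂]; exact hj
    · rw [if_neg hj, hsign]
  rw [← hw₀, ← hw₁]
  exact hlc.apply_eq_of_preconnectedSpace 0 1

theorem eq_or_eq_neg_units (a b : ℤˣ) : a = b ∨ a = -b := by
  revert a b; decide

theorem form_inl_single (ε μ : Fin n → ℤˣ) (c : Fin n) :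
    form (Sum.inl μ) (Pi.single c ((ε c : ℤ) : ℝ)) = if μ c = ε c then 0 else -2 := by
  rw [form_inl_eq, linForm_inl_single]
  split_ifs with h
  · rw [h, unit_mul_self, sub_self]
  · rw [(eq_or_eq_neg_units _ _).resolve_left h]
    push_cast
    linear_combination - unit_mul_self (ε c)

theorem exists_sign_eq_one {ε : Fin n → ℤˣ} {x : Fin n → ℝ} (hx : ∀ i, 0 ≤ x i)
    (h : form (Sum.inl ε) x = 0) : ∃ k, ε k = 1 ∧ x k ≠ 0 := by
  by_contra! hk
  have : ∑ i, ((ε i : ℤ) : ℝ) * x i ≤ 0 := Finset.sum_nonpos fun i _ => by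
    rcases Int.units_eq_one_or (ε i) with h1 | h1
    · rw [hk i h1]; simp
    · rw [h1]; simp [hx i]
  simp only [form] at h
  linarith

/-- Two hyperplanes with a common point have normal vectors that agree somewhere. -/
theorem exists_sign_eq {ε ε' : Fin n → ℤˣ} {x : Fin n → ℝ} (h : form (Sum.inl ε) x = 0)
    (h' : form (Sum.inl ε') x = 0) : ∃ k, ε k = ε' k := by
  by_contra! hk
  have h1 : ∑ i, ((ε i : ℤ) : ℝ) * x i = - ∑ i, ((ε' i : ℤ) : ℝ) * x i := by
    rw [← Finset.sum_neg_distrib]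
    refine Finset.sum_congr rfl fun i _ => ?_
    rw [(eq_or_eq_neg_units (ε i) (ε' i)).resolve_left (hk i)]
    push_cast; ring
  simp only [form] at h h'
  linarith

theorem exists_sign_eq_neg {ε ε' : Fin n → ℤˣ} (h : ε ≠ ε') : ∃ m, ε' m = -ε m := by
  obtain ⟨m, hm⟩ := Function.ne_iff.1 h
  exact ⟨m, (eq_or_eq_neg_units _ _).resolve_left (Ne.symm hm)⟩

/-! ### The loops across the hyperplanes of the arrangement -/

theorem eq_signAt_of_isWall {x : Fin n → ℝ} {j₀ : (Fin n → ℤˣ) ⊕ Fin n}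
    {s : (Fin n → ℤˣ) ⊕ Fin n → SignType} (hs : IsWall s j₀)
    (hsx : ∀ j, form j x ≠ 0 → s j = signAt x j) (hx : ∀ j, form j x = 0 → j = j₀)
    (hx₀ : form j₀ x = 0) : s = signAt x := by
  funext j
  by_cases hj : form j x = 0
  · rw [hx j hj, (hs.eq_zero_iff j₀).2 rfl, signAt_eq_zero.2 hx₀]
  · exact hsx j hj

theorem signType_eq_one_or {a : SignType} (h : a ≠ 0) : a = 1 ∨ a = -1 := by
  revert h; revert a; decide

/-- All walls of `H_ε` in the positive orthant, crossed towards the origin, give the same loop. -/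
theorem wallLoop_inl_eq [NeZero n] (v : VertexChoice n) {ε : Fin n → ℤˣ}
    {s s' : (Fin n → ℤˣ) ⊕ Fin n → SignType} (hs : IsOrthantWall s (Sum.inl ε))
    (hs' : IsOrthantWall s' (Sum.inl ε)) :
    wallLoop v s (Sum.inl ε) (-1) = wallLoop v s' (Sum.inl ε) (-1) := by
  refine eq_of_forall_codim_two (fun s => wallLoop v s (Sum.inl ε) (-1)) (· = ·) ?_ ?_ hs hs'
  · intro y hy μ ν hμ hν hne
    obtain ⟨c, hc⟩ := Function.ne_iff.1 hne
    have hμy : form (Sum.inl μ) y ≠ 0 := fun h => hμ ((hy _).1 h)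
    have hνy : form (Sum.inl ν) y ≠ 0 := fun h => hν ((hy _).1 h)
    refine ⟨Pi.single c ((ε c : ℤ) : ℝ), by rw [form_inl_single, if_pos rfl], ?_⟩
    rw [form_inl_single, form_inl_single]
    -- exactly one of `μ c` and `ν c` is equal to `ε c`
    by_cases h1 : μ c = ε c
    · have h2 : ν c ≠ ε c := fun h2 => hc (h1.trans h2.symm)
      simp [h1, h2, hμy]
    · have h2 : ν c = ε c := by
        rw [(eq_or_eq_neg_units (μ c) (ε c)).resolve_left h1] at hc
        by_contra h2
        exact hc ((eq_or_eq_neg_units (ν c) (ε c)).resolve_left h2).symm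
      simp [h1, h2, hνy]
  · intro x hx hpos hR s s' hs hs' hsx hsx'
    have hpos' : ∀ i, 0 < x i := fun i => hpos i (by simp)
    by_cases hex : ∃ ε', ε' ≠ ε ∧ form (Sum.inl ε') x = 0
    · obtain ⟨ε', hε', hx'⟩ := hex
      obtain ⟨k, hk⟩ := exists_sign_eq hx hx'
      obtain ⟨m, hm⟩ := exists_sign_eq_neg hε'.symm
      have hz : ∀ j, form j x = 0 ↔ j = Sum.inl ε ∨ j = Sum.inl ε' := by
        refine fun j => ⟨fun hj => ?_, ?_⟩
        · rcases j with μ | i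
          · by_cases hμ : μ = ε
            · exact Or.inl (by rw [hμ])
            · exact Or.inr (by rw [hR μ ε' (by simpa using hμ) (by simpa using hε') hj hx'])
          · exact ((hpos' i).ne' hj).elim
        · rintro (rfl | rfl) <;> assumption
      obtain ⟨-, -, h, -⟩ := wallLoop_of_two_hyperplanes v hk hm hpos' hz rfl
      have hT : ∀ s, IsWall s (Sum.inl ε) → (∀ j, form j x ≠ 0 → s j = signAt x j) →
          s = Function.update (Function.update (signAt x) (Sum.inl ε) 0) (Sum.inl ε')
            (s (Sum.inl ε')) := by
        intro s hs hsx
        funext j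
        by_cases hj : form j x = 0
        · rcases (hz j).1 hj with rfl | rfl
          · simp [hε'.symm, hs.eq_zero_iff]
          · simp
        · have hj' := mt (hz j).2 hj
          push Not at hj'
          simp [hj'.1, hj'.2, hsx j hj]
      have hval : ∀ s, IsWall s (Sum.inl ε) → (∀ j, form j x ≠ 0 → s j = signAt x j) →
          wallLoop v s (Sum.inl ε) (-1) = wallLoop v (Function.update (Function.update (signAt x)
            (Sum.inl ε) 0) (Sum.inl ε') 1) (Sum.inl ε) (-1) := by
        intro s hs hsx
        have hne : s (Sum.inl ε') ≠ 0 := by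
          rw [Ne, hs.eq_zero_iff]; simpa using hε'
        rw [hT s hs hsx]
        rcases signType_eq_one_or hne with h1 | h1
        · rw [h1]
        · rw [h1]; exact h
      rw [hval s hs hsx, hval s' hs' hsx']
    · have hx1 : ∀ j, form j x = 0 → j = Sum.inl ε := by
        rintro (μ | i) hj
        · by_contra hμ
          exact hex ⟨μ, by simpa using hμ, hj⟩
        · exact ((hpos' i).ne' hj).elim
      rw [eq_signAt_of_isWall hs hsx hx1 hx, eq_signAt_of_isWall hs' hsx' hx1 hx]

theorem mul_reflection_apply_of_ne (ε : Fin n → ℤˣ) {i m : Fin n} (h : i ≠ m) :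
    (ε * reflection m) i = ε i := by
  simp [reflection, h]

theorem mul_reflection_apply_self (ε : Fin n → ℤˣ) (m : Fin n) :
    (ε * reflection m) m = -ε m := by
  simp [reflection]

theorem form_mul_reflection (ε : Fin n → ℤˣ) {m : Fin n} {x : Fin n → ℝ} (hx : x m = 0) :
    form (Sum.inl (ε * reflection m)) x = form (Sum.inl ε) x := by
  simp only [form]
  congr 1
  refine Finset.sum_congr rfl fun i _ => ?_
  by_cases hi : i = m
  · rw [hi, hx]; simp
  · rw [mul_reflection_apply_of_ne _ hi]

/-- Sign vectors that agree away from `m` with `ε` are `ε` and its reflection. -/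
theorem eq_or_eq_mul_reflection {ε μ : Fin n → ℤˣ} {m : Fin n} (h : ∀ i, i ≠ m → μ i = ε i) :
    μ = ε ∨ μ = ε * reflection m := by
  rcases eq_or_eq_neg_units (μ m) (ε m) with hm | hm
  · refine Or.inl (funext fun i => ?_)
    by_cases hi : i = m
    · rw [hi, hm]
    · exact h i hi
  · refine Or.inr (funext fun i => ?_)
    by_cases hi : i = m
    · rw [hi, hm, mul_reflection_apply_self]
    · rw [h i hi, mul_reflection_apply_of_ne _ hi]

/-- All walls of `L_m` in the closed positive orthant, crossed from `x_m > 0` to `x_m < 0`, give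
the same loop. -/
theorem wallLoop_inr_eq [NeZero n] (v : VertexChoice n) {m : Fin n}
    {s s' : (Fin n → ℤˣ) ⊕ Fin n → SignType} (hs : IsOrthantWall s (Sum.inr m))
    (hs' : IsOrthantWall s' (Sum.inr m)) :
    wallLoop v s (Sum.inr m) (-1) = wallLoop v s' (Sum.inr m) (-1) := by
  refine eq_of_forall_codim_two (fun s => wallLoop v s (Sum.inr m) (-1))
    (fun μ ν => ∀ i, i ≠ m → μ i = ν i) ?_ ?_ hs hs'
  · intro y hy μ ν hμ hν hne
    push Not at hne
    obtain ⟨c, hcm, hc⟩ := hne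
    have hμy : form (Sum.inl μ) y ≠ 0 := fun h => hμ ((hy _).1 h)
    refine ⟨Pi.single c ((μ c : ℤ) : ℝ), Pi.single_eq_of_ne hcm.symm _, ?_⟩
    rw [form_inl_single, form_inl_single]
    simp [hc.symm, hμy]
  · intro x hx hpos hR s s' hs hs' hsx hsx'
    have hxm : x m = 0 := hx
    have hpos' : ∀ i, i ≠ m → 0 < x i := fun i hi => hpos i (by simpa using hi)
    by_cases hex : ∃ ε, form (Sum.inl ε) x = 0
    · obtain ⟨ε, hm, hxε⟩ : ∃ ε : Fin n → ℤˣ, ε m = 1 ∧ form (Sum.inl ε) x = 0 := by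
        obtain ⟨ε, hε⟩ := hex
        rcases Int.units_eq_one_or (ε m) with h | h
        · exact ⟨ε, h, hε⟩
        · exact ⟨ε * reflection m, by rw [mul_reflection_apply_self, h, neg_neg],
            by rw [form_mul_reflection _ hxm, hε]⟩
      have hxnn : ∀ i, 0 ≤ x i := fun i => by
        by_cases hi : i = m
        · rw [hi, hxm]
        · exact (hpos' i hi).le
      obtain ⟨k, -, hk⟩ := exists_sign_eq_one hxnn hxε
      have hkm : k ≠ m := by rintro rfl; exact hk hxm
      have hz : ∀ j, form j x = 0 ↔ j = Sum.inl ε ∨ j = Sum.inl (ε * reflection m) ∨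
          j = Sum.inr m := by
        refine fun j => ⟨fun hj => ?_, ?_⟩
        · rcases j with μ | i
          · rcases eq_or_eq_mul_reflection (hR μ ε (by simp) (by simp) hj hxε) with h | h
            · exact Or.inl (by rw [h])
            · exact Or.inr (Or.inl (by rw [h]))
          · by_cases hi : i = m
            · exact Or.inr (Or.inr (by rw [hi]))
            · exact ((hpos' i hi).ne' hj).elim
        · rintro (rfl | rfl | rfl)
          · exact hxε
          · rw [form_mul_reflection _ hxm, hxε]
          · exact hx
      obtain ⟨-, -, -, h, -⟩ := wallLoop_of_three_hyperplanes v
        (mul_reflection_apply_of_ne ε hkm).symm hm rfl hpos' hz rfl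
      have hT : ∀ s, IsWall s (Sum.inr m) → (∀ j, form j x ≠ 0 → s j = signAt x j) →
          s = Function.update (Function.update (Function.update (signAt x) (Sum.inl ε)
            (s (Sum.inl ε))) (Sum.inl (ε * reflection m)) (s (Sum.inl ε))) (Sum.inr m) 0 := by
        intro s hs hsx
        obtain ⟨y, hy⟩ := hs.nonempty
        have hym : y m = 0 := by
          have := hy (Sum.inr m)
          rwa [(hs.eq_zero_iff _).2 rfl, sign_eq_zero_iff] at this
        have hsε : s (Sum.inl (ε * reflection m)) = s (Sum.inl ε) := by
          rw [← hy, ← hy, form_mul_reflection _ hym]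
        funext j
        by_cases hj : form j x = 0
        · by_cases h2 : j = Sum.inl (ε * reflection m)
          · subst h2; simp [hsε]
          · rcases (hz j).1 hj with rfl | rfl | rfl
            · rw [Function.update_of_ne (by simp), Function.update_of_ne h2, Function.update_self]
            · exact (h2 rfl).elim
            · simp [hs.eq_zero_iff]
        · have hj' := mt (hz j).2 hj
          push Not at hj'
          rw [Function.update_of_ne hj'.2.2, Function.update_of_ne hj'.2.1,
            Function.update_of_ne hj'.1, hsx j hj]
      have hval : ∀ s, IsWall s (Sum.inr m) → (∀ j, form j x ≠ 0 → s j = signAt x j) →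
          wallLoop v s (Sum.inr m) (-1) = wallLoop v (Function.update (Function.update
            (Function.update (signAt x) (Sum.inl ε) 1) (Sum.inl (ε * reflection m)) 1)
            (Sum.inr m) 0) (Sum.inr m) (-1) := by
        intro s hs hsx
        have hne : s (Sum.inl ε) ≠ 0 := by
          rw [Ne, hs.eq_zero_iff]; simp
        rw [hT s hs hsx]
        rcases signType_eq_one_or hne with h1 | h1
        · rw [h1]
        · rw [h1]; exact h.symm
      rw [hval s hs hsx, hval s' hs' hsx']
    · have hx1 : ∀ j, form j x = 0 → j = Sum.inr m := by
        rintro (μ | i) hj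
        · exact (hex ⟨μ, hj⟩).elim
        · by_contra hi
          exact (hpos' i (by simpa using hi)).ne' hj
      rw [eq_signAt_of_isWall hs hsx hx1 hx, eq_signAt_of_isWall hs' hsx' hx1 hx]

/-- A point in general position in `H_ε ∩ L_m` and the closed positive orthant. -/
theorem exists_general_point_coord [NeZero n] {ε : Fin n → ℤˣ} {k m : Fin n} (hkm : k ≠ m)
    (hk : ε k = 1) : ∃ x : Fin n → ℝ, (∀ i, i ≠ m → 0 < x i) ∧
      ∀ j, form j x = 0 ↔ j = Sum.inl ε ∨ j = Sum.inl (ε * reflection m) ∨ j = Sum.inr m := by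
  classical
  have hn : (0 : ℝ) < n := by exact_mod_cast Nat.pos_of_ne_zero (NeZero.ne n)
  -- a point of the intersection: small coordinates, corrected at `k`
  set w : Fin n → ℝ := fun i => if i = m then 0 else 1 / (n : ℝ) with hw
  have hw0 : ∀ i, 0 ≤ w i := fun i => by rw [hw]; dsimp only; split_ifs <;> positivity
  have hwpos : ∀ i, i ≠ m → 0 < w i := fun i hi => by
    rw [hw]; dsimp only; rw [if_neg hi]; positivity
  have hwsum : ∑ i, w i ≤ 1 := by
    have : ∑ i, w i ≤ ∑ _i : Fin n, 1 / (n : ℝ) := Finset.sum_le_sum fun i _ => by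
      rw [hw]; dsimp only; split_ifs
      · positivity
      · exact le_rfl
    simp only [Finset.sum_const, Finset.card_univ, Fintype.card_fin, nsmul_eq_mul] at this
    rwa [mul_one_div_cancel hn.ne'] at this
  have hwε : linForm (Sum.inl ε) w ≤ 1 := by
    rw [linForm_inl_apply]; exact (sum_signs_le ε hw0).trans hwsum
  set x₀ : Fin n → ℝ := w + Pi.single k (1 - linForm (Sum.inl ε) w) with hx₀
  have hx₀m : x₀ m = 0 := by simp [hx₀, hw, hkm.symm]
  have hx₀ε : form (Sum.inl ε) x₀ = 0 := by
    rw [form_inl_eq, hx₀, map_add, linForm_inl_single, hk]; simp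
  have hx₀pos : ∀ i, i ≠ m → 0 < x₀ i := fun i hi => by
    by_cases hik : i = k
    · subst hik
      have := hwpos i hi
      simp only [hx₀, Pi.add_apply, Pi.single_eq_same]; linarith
    · simpa [hx₀, hik] using hwpos i hi
  obtain ⟨x, ⟨⟨hxε, hxm⟩, hxN⟩, hx⟩ := exists_forall_ne_zero
    (Finset.univ.filter fun μ : Fin n → ℤˣ => μ ≠ ε ∧ μ ≠ ε * reflection m)
    (fun μ z => form (Sum.inl μ) z) (fun μ x y a b hab => form_comb _ _ _ hab)
    (M := {z | form (Sum.inl ε) z = 0 ∧ form (Sum.inr m) z = 0})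
    (fun x hx y hy a b hab => ⟨form_comb_mem hx.1 hy.1 hab, form_comb_mem hx.2 hy.2 hab⟩)
    (fun μ hμ => by
      obtain ⟨h1, h2⟩ := (Finset.mem_filter.1 hμ).2
      obtain ⟨c, hcm, hc⟩ : ∃ c, c ≠ m ∧ μ c ≠ ε c := by
        by_contra! h
        exact (eq_or_eq_mul_reflection h).elim h1 h2
      refine ⟨Pi.single c ((ε c : ℤ) : ℝ), ⟨by rw [form_inl_single, if_pos rfl],
        Pi.single_eq_of_ne hcm.symm _⟩, ?_⟩
      rw [form_inl_single, if_neg hc]; norm_num)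
    ⟨hx₀ε, hx₀m⟩ (eventually_signAt_eq x₀)
  have hxpos : ∀ i, i ≠ m → 0 < x i := fun i hi => by
    have h1 := hxN (Sum.inr i) (hx₀pos i hi).ne'
    have h2 : signAt x₀ (Sum.inr i) = 1 := sign_pos (hx₀pos i hi)
    exact sign_eq_one_iff.1 (h1.trans h2)
  refine ⟨x, hxpos, fun j => ⟨fun hj => ?_, ?_⟩⟩
  · rcases j with μ | i
    · by_contra! h
      exact hx μ (Finset.mem_filter.2 ⟨Finset.mem_univ _, by simpa using h.1,
        by simpa using h.2.1⟩) hj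
    · by_cases hi : i = m
      · exact Or.inr (Or.inr (by rw [hi]))
      · exact ((hxpos i hi).ne' hj).elim
  · rintro (rfl | rfl | rfl)
    · exact hxε
    · rw [form_mul_reflection _ hxm, hxε]
    · exact hxm

/-- A point in general position in `H_ε ∩ H_ε'` and the open positive orthant. -/
theorem exists_general_point {ε ε' : Fin n → ℤˣ} {x₀ : Fin n → ℝ} (hx₀ : ∀ i, 0 < x₀ i)
    (h : form (Sum.inl ε) x₀ = 0) (h' : form (Sum.inl ε') x₀ = 0) :
    ∃ x : Fin n → ℝ, (∀ i, 0 < x i) ∧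
      ∀ j, form j x = 0 ↔ j = Sum.inl ε ∨ j = Sum.inl ε' := by
  classical
  obtain ⟨k, hk⟩ := exists_sign_eq h h'
  obtain ⟨x, ⟨⟨hxε, hxε'⟩, hxN⟩, hx⟩ := exists_forall_ne_zero
    (Finset.univ.filter fun μ : Fin n → ℤˣ => μ ≠ ε ∧ μ ≠ ε')
    (fun μ z => form (Sum.inl μ) z) (fun μ x y a b hab => form_comb _ _ _ hab)
    (M := {z | form (Sum.inl ε) z = 0 ∧ form (Sum.inl ε') z = 0})
    (fun x hx y hy a b hab => ⟨form_comb_mem hx.1 hy.1 hab, form_comb_mem hx.2 hy.2 hab⟩)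
    (fun μ hμ => by
      obtain ⟨h1, h2⟩ := (Finset.mem_filter.1 hμ).2
      by_cases hex : ∃ c, ε c = ε' c ∧ μ c ≠ ε c
      · obtain ⟨c, hc, hμc⟩ := hex
        refine ⟨Pi.single c ((ε c : ℤ) : ℝ), ⟨by rw [form_inl_single, if_pos rfl],
          by rw [form_inl_single, if_pos hc.symm]⟩, ?_⟩
        rw [form_inl_single, if_neg hμc]; norm_num
      · -- `μ` agrees with `ε` at `a` and with `ε'` at `b`, where `ε` and `ε'` differ
        push Not at hex
        obtain ⟨b, hb⟩ := Function.ne_iff.1 h1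
        obtain ⟨a, ha⟩ := Function.ne_iff.1 h2
        have hb1 : μ b = -ε b := (eq_or_eq_neg_units _ _).resolve_left hb
        have hb2 : ε' b = -ε b := (eq_or_eq_neg_units _ _).resolve_left
          fun he => hb (hex b he.symm)
        have ha0 : ε a ≠ ε' a := fun he => ha ((hex a he).trans he)
        have ha2 : ε' a = -ε a := (eq_or_eq_neg_units _ _).resolve_left ha0.symm
        have ha1 : μ a = ε a := by
          have := (eq_or_eq_neg_units _ _).resolve_left ha
          rw [this, ha2, neg_neg]
        have hμk : μ k = ε k := hex k hk
        have e1 := unit_mul_self (ε k)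
        have e2 := unit_mul_self (ε a)
        have e3 := unit_mul_self (ε b)
        refine ⟨Pi.single k ((ε k : ℤ) : ℝ) + Pi.single a ((ε a : ℤ) : ℝ)
          + Pi.single b (-((ε b : ℤ) : ℝ)), ⟨?_, ?_⟩, ?_⟩
        · rw [form_inl_eq, map_add, map_add, linForm_inl_single, linForm_inl_single,
            linForm_inl_single]
          linear_combination e1 + e2 - e3
        · rw [form_inl_eq, map_add, map_add, linForm_inl_single, linForm_inl_single,
            linForm_inl_single, ← hk, ha2, hb2]
          push_cast
          linear_combination e1 - e2 + e3
        · rw [form_inl_eq, map_add, map_add, linForm_inl_single, linForm_inl_single,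
            linForm_inl_single, hμk, ha1, hb1]
          push_cast
          have : ((ε k : ℤ) : ℝ) * ((ε k : ℤ) : ℝ) + ((ε a : ℤ) : ℝ) * ((ε a : ℤ) : ℝ)
            + -((ε b : ℤ) : ℝ) * -((ε b : ℤ) : ℝ) - 1 = 2 := by
            linear_combination e1 + e2 + e3
          rw [this]; norm_num)
    ⟨h, h'⟩ (eventually_signAt_eq x₀)
  have hxpos : ∀ i, 0 < x i := fun i => by
    have h1 := hxN (Sum.inr i) (hx₀ i).ne'
    have h2 : signAt x₀ (Sum.inr i) = 1 := sign_pos (hx₀ i)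
    exact sign_eq_one_iff.1 (h1.trans h2)
  refine ⟨x, hxpos, fun j => ⟨fun hj => ?_, ?_⟩⟩
  · rcases j with μ | i
    · by_contra! h
      exact hx μ (Finset.mem_filter.2 ⟨Finset.mem_univ _, by simpa using h.1,
        by simpa using h.2⟩) hj
    · exact ((hxpos i).ne' hj).elim
  · rintro (rfl | rfl)
    · exact hxε
    · exact hxε'

theorem isOrthantWall_signOfTauZero (n : ℕ) [NeZero n] :
    IsOrthantWall (signOfTauZero n) (Sum.inl 1) where
  nonempty := by rw [← tauZero_eq]; exact tauZero_nonempty n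
  eq_zero_iff := by
    rintro (ε | i)
    · by_cases h : ε = 1 <;> simp [signOfTauZero, h]
    · simp [signOfTauZero]
  eq_one _ _ := rfl

theorem isOrthantWall_signOfTauCoord (m : Fin n) :
    IsOrthantWall (signOfTauCoord m) (Sum.inr m) where
  nonempty := by rw [← tauCoord_eq]; exact tauCoord_nonempty m
  eq_zero_iff := by
    rintro (ε | i)
    · simp [signOfTauCoord]
    · by_cases h : i = m <;> simp [signOfTauCoord, h]
  eq_one i hi := by
    have : i ≠ m := fun h => hi (by rw [h])
    simp [signOfTauCoord, this]

theorem gammaZero_eq [NeZero n] (v : VertexChoice n) :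
    gammaZero v = wallLoop v (signOfTauZero n) (Sum.inl 1) (-1) := by
  refine Arrow.loop_eq_wallLoop v _ ?_ (tauZero_eq n) ?_
  · refine (sigmaOut_eq n).trans (congrArg _ ?_)
    funext j
    rcases j with ε | i
    · by_cases h : ε = 1 <;> simp [signOfSigmaOut, signOfTauZero, h]
    · simp [signOfSigmaOut, signOfTauZero]
  · refine (sigmaZero_eq n).trans (congrArg _ ?_)
    funext j
    rcases j with ε | i
    · by_cases h : ε = 1 <;> simp [signOfSigmaZero, signOfTauZero, h]
    · simp [signOfSigmaZero, signOfTauZero]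

theorem gamma_eq (v : VertexChoice n) (m : Fin n) :
    gamma v m = wallLoop v (signOfTauCoord m) (Sum.inr m) (-1) := by
  refine Arrow.loop_eq_wallLoop v _ ?_ (tauCoord_eq m) ?_
  · refine (sigmaZero_eq n).trans (congrArg _ ?_)
    funext j
    rcases j with ε | i
    · simp [signOfSigmaZero, signOfTauCoord]
    · by_cases h : i = m <;> simp [signOfSigmaZero, signOfTauCoord, h]
  · refine (sigmaReflected_eq m).trans (congrArg _ ?_)
    funext j
    rcases j with ε | i
    · simp [signOfSigmaReflected, signOfTauCoord]
    · by_cases h : i = m <;> simp [signOfSigmaReflected, signOfTauCoord, h]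

/-- The loop across `H_ε` towards the origin, in the positive orthant, is the conjugate of `γ₀` by
the product of the `γᵢ` with `εᵢ = -1`, in any order. -/
theorem wallLoop_eq_conj [NeZero n] (v : VertexChoice n) (l : List (Fin n)) (hl : l.Nodup)
    {ε : Fin n → ℤˣ} (hlε : ∀ i, i ∈ l ↔ ε i = -1) (hε : ∃ k, ε k = 1)
    {s : (Fin n → ℤˣ) ⊕ Fin n → SignType} (hs : IsOrthantWall s (Sum.inl ε)) :
    wallLoop v s (Sum.inl ε) (-1) = (gammaProd v l)⁻¹ * gammaZero v * gammaProd v l := by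
  induction l using List.reverseRecOn generalizing ε s with
  | nil =>
    have h1 : ε = 1 := funext fun i =>
      (Int.units_eq_one_or (ε i)).resolve_right fun h => by simpa using (hlε i).2 h
    subst h1
    rw [wallLoop_inl_eq v hs (isOrthantWall_signOfTauZero n), ← gammaZero_eq]
    simp [gammaProd]
  | append_singleton l m ih =>
    obtain ⟨k, hk⟩ := hε
    have hm : ε m = -1 := (hlε m).1 (by simp)
    have hkm : k ≠ m := by
      rintro rfl
      rw [hk] at hm
      exact absurd hm (by decide)
    -- `μ` arises from `ε` by changing the last sign of the list
    set μ := ε * reflection m with hμ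
    have hμε : ε = μ * reflection m := by rw [hμ, mul_assoc, units_pi_mul_self, mul_one]
    have hμm : μ m = 1 := by rw [hμ, mul_reflection_apply_self, hm, neg_neg]
    have hμk : μ k = 1 := by rw [hμ, mul_reflection_apply_of_ne _ hkm, hk]
    have hmem : m ∉ l := fun h => (List.nodup_append.1 hl).2.2 m h m (by simp) rfl
    have hlμ : ∀ i, i ∈ l ↔ μ i = -1 := fun i => by
      by_cases hi : i = m
      · subst hi
        rw [hμm]
        exact iff_of_false hmem (by decide)
      · rw [hμ, mul_reflection_apply_of_ne _ hi, ← hlε]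
        simp [hi]
    obtain ⟨x, hpos, hz⟩ := exists_general_point_coord (ε := μ) hkm hμk
    rw [← hμε] at hz
    obtain ⟨w1, w2, w3, -, h⟩ := wallLoop_of_three_hyperplanes v
      (hμk.trans hk.symm) hμm hμε hpos hz rfl
    rw [ih (List.nodup_append.1 hl).1 hlμ ⟨k, hμk⟩ w1, ← wallLoop_inl_eq v hs w2,
      wallLoop_inr_eq v w3 (isOrthantWall_signOfTauCoord m), ← gamma_eq] at h
    rw [← eq_inv_mul_iff_mul_eq] at h
    rw [h]
    simp only [gammaProd, List.map_append, List.prod_append, List.map_singleton,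
      List.prod_singleton]
    group

end GeneralPosition

end LauricellaFC

theorem mainTheorem3 (n : ℕ) [NeZero n] (v : LauricellaFC.VertexChoice n)
    (ε ε' : Fin n → ℤˣ)
    (hne : (LauricellaFC.hypEps ε ∩ LauricellaFC.hypEps ε' ∩
      {x : Fin n → ℝ | ∀ i, 0 < x i}).Nonempty)
    (l l' : List (Fin n))
    (hl : l.Nodup) (hlε : ∀ i, i ∈ l ↔ ε i = -1)
    (hl' : l'.Nodup) (hlε' : ∀ i, i ∈ l' ↔ ε' i = -1) :
    ⁅(LauricellaFC.gammaProd v l)⁻¹ * LauricellaFC.gammaZero v * LauricellaFC.gammaProd v l,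
      (LauricellaFC.gammaProd v l')⁻¹ * LauricellaFC.gammaZero v *
        LauricellaFC.gammaProd v l'⁆ = 1 := by
  open LauricellaFC in
  obtain ⟨x₀, ⟨hx₀, hx₀'⟩, hpos₀⟩ := hne
  have h0 : form (Sum.inl ε) x₀ = 0 := sub_eq_zero.2 hx₀
  have h0' : form (Sum.inl ε') x₀ = 0 := sub_eq_zero.2 hx₀'
  have hnn : ∀ i, 0 ≤ x₀ i := fun i => (hpos₀ i).le
  obtain ⟨c, hc, -⟩ := exists_sign_eq_one hnn h0
  obtain ⟨c', hc', -⟩ := exists_sign_eq_one hnn h0'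
  obtain ⟨x, hpos, hz⟩ := exists_general_point hpos₀ h0 h0'
  rw [commutatorElement_eq_one_iff_mul_comm]
  by_cases hεε' : ε = ε'
  · subst hεε'
    -- the two conjugates are the loop of one and the same wall
    have hw : IsOrthantWall (signAt x) (Sum.inl ε) :=
      ⟨⟨⟨x, mem_signCell_signAt x⟩, fun j => by rw [signAt_eq_zero, hz, or_self]⟩,
        fun i _ => sign_pos (hpos i)⟩
    rw [← wallLoop_eq_conj v l hl hlε ⟨c, hc⟩ hw, ← wallLoop_eq_conj v l' hl' hlε' ⟨c, hc⟩ hw]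
  · obtain ⟨k, hk⟩ := exists_sign_eq h0 h0'
    obtain ⟨m, hm⟩ := exists_sign_eq_neg hεε'
    obtain ⟨w, w', -, h⟩ := wallLoop_of_two_hyperplanes v hk hm hpos hz rfl
    rw [← wallLoop_eq_conj v l hl hlε ⟨c, hc⟩ w, ← wallLoop_eq_conj v l' hl' hlε' ⟨c', hc'⟩ w']
    exact h
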